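/- Let $X$ be a non-empty complete CAT(0) space, i.e. a complete geodesic metric space such that for all $x,c,c'\in X$ the midpoint $m$ of any geodesic between $c$ and $c'$ satisfies $2d^2(m,x)\le d^2(c',x)+d^2(c,x)-\tfrac12 d^2(c',c)$. Let $G=G_1\times\cdots\times G_n$ be a product of arbitrary topological groups, acting continuously by isometries on $X$. The action is called *evanescent* if there is an unbounded set $T\subseteq X$ such that for every compact set $Q\subseteq G$ the set $\{d(gx,x): g\in Q,\ x\in T\}$ is bounded. A non-empty closed convex invariant subspace is called *minimal* if it contains no strictly smaller one. Then either the $G$-action on $X$ is evanescent, or there is a canonical non-empty closed convex $G$-invariant subspace $Z\subseteq X$ which splits $G$-equivariantly and isometrically as a product of $G_i$-spaces. More precisely, in the second case: (a) Let $\mathcal T$ be the set of all minimal non-empty closed convex $G$-invariant subspaces of $X$, with the distance $d(C,C')=\inf\{d(x,y): x\in C,\ y\in C'\}$. Then there is exactly one $Z\in\mathcal T$ that is a circumcentre of $\mathcal T$, i.e. such that $\mathcal T$ lies in the closed ball around $Z$ of radius $\varrho$, where $\varrho<\infty$ is the smallest radius of a closed ball centred in $\mathcal T$ and containing $\mathcal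 T$. In particular $\varphi(Z)=Z$ for every isometry $\varphi$ of $X$ onto itself for which there is a group automorphism $\psi$ of $G$ with $\varphi(gx)=\psi(g)\varphi(x)$ for all $g\in G$, $x\in X$. (b) There are complete CAT(0) spaces $Z_1,\dots,Z_n$, each $Z_i$ with a continuous isometric action of $G_i$, and an isometry $\alpha$ of $Z$ onto the product $Z_1\times\cdots\times Z_n$ (with the metric $d^2(z,w)=\sum_i d^2(z_i,w_i)$), such that $\alpha(gz)_i=g_i\,\alpha(z)_i$ for all $g=(g_1,\dots,g_n)\in G$, $z\in Z$ and all $i$. Moreover each $Z_i$ is minimal: it has no non-empty closed convex $G_i$-invariant subset other than $Z_i$ itself. -/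

import Mathlib

namespace CatZero

/-- `γ`, restricted to `[0, dist x y]`, is a geodesic from `x` to `y`. -/
structure IsGeodesic {X : Type*} [MetricSpace X] (x y : X) (γ : ℝ → X) : Prop where
  source : γ 0 = x
  target : γ (dist x y) = y
  isometry : ∀ s ∈ Set.Icc 0 (dist x y), ∀ t ∈ Set.Icc 0 (dist x y),
    dist (γ s) (γ t) = |s - t|

/-- A CAT(0) space: a geodesic metric space satisfying the Bruhat-Tits inequality at the midpoint
of every geodesic. -/
structure IsCAT0 (X : Type*) [MetricSpace X] : Prop where
  exists_geodesic : ∀ x y : X, ∃ γ : ℝ → X, IsGeodesic x y γ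
  bruhat_tits : ∀ (x c c' : X) (γ : ℝ → X), IsGeodesic c c' γ →
    2 * dist (γ (dist c c' / 2)) x ^ 2 ≤
      dist c' x ^ 2 + dist c x ^ 2 - (1 / 2) * dist c' c ^ 2

/-- Geodesic convexity. -/
def IsGeodConvex {X : Type*} [MetricSpace X] (C : Set X) : Prop :=
  ∀ x ∈ C, ∀ y ∈ C, ∀ γ : ℝ → X, IsGeodesic x y γ → ∀ t ∈ Set.Icc 0 (dist x y), γ t ∈ C

/-- Evanescence of an action (meant for continuous actions by isometries). -/
def IsEvanescent (G X : Type*) [Group G] [TopologicalSpace G] [MetricSpace X] [MulAction G X] :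
    Prop :=
  ∃ T : Set X, ¬ Bornology.IsBounded T ∧
    ∀ Q : Set G, IsCompact Q →
      Bornology.IsBounded {r : ℝ | ∃ g ∈ Q, ∃ x ∈ T, r = dist (g • x) x}

/-- `C` is a non-empty closed convex `G`-invariant subspace of `X`. -/
structure IsInvariantSubspace (G : Type*) {X : Type*} [Group G] [MetricSpace X] [MulAction G X]
    (C : Set X) : Prop where
  nonempty : C.Nonempty
  isClosed : IsClosed C
  convex : IsGeodConvex C
  smul_mem : ∀ g : G, ∀ x ∈ C, g • x ∈ C

/-- `C` is minimal, for inclusion, among the non-empty closed convex `G`-invariant subspaces. -/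
def IsMinimalSubspace (G : Type*) {X : Type*} [Group G] [MetricSpace X] [MulAction G X]
    (C : Set X) : Prop :=
  Minimal (IsInvariantSubspace G) C

/-- The distance `d(C, C') = inf {d(x, y) : x ∈ C, y ∈ C'}` between two non-empty sets. -/
noncomputable def setDist {X : Type*} [MetricSpace X] (C C' : Set X) : ℝ :=
  sInf {r : ℝ | ∃ x ∈ C, ∃ y ∈ C', r = dist x y}

/-- `C₀` is a circumcentre of the space of components, that is, of the set of all minimal
non-empty closed convex `G`-invariant subspaces with the distance `setDist`: this set is contained
in the closed ball around `C₀` of radius `ρ`, where `ρ` is the smallest radius of a closed ball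
(centred at a component) that contains it. -/
def IsCentralComponent (G : Type*) {X : Type*} [Group G] [MetricSpace X] [MulAction G X]
    (C₀ : Set X) : Prop :=
  IsMinimalSubspace G C₀ ∧
    ∃ ρ : ℝ, (∀ C' : Set X, IsMinimalSubspace G C' → setDist C₀ C' ≤ ρ) ∧
      ∀ (C : Set X) (r : ℝ), IsMinimalSubspace G C →
        (∀ C' : Set X, IsMinimalSubspace G C' → setDist C C' ≤ r) → ρ ≤ r

end CatZero

universe u v

/-!
On a minimal subspace every invariant continuous convex function is constant. Applied to the
distance to another minimal subspace, this makes any two minimal subspaces parallel, with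
equivariant isometric projections between them.

If the action is not evanescent, the points that no group element moves further than it moves `x`
form a bounded set. Hence minimal subspaces exist, by compactness of bounded closed convex sets and
Zorn's lemma. An equivariant isometric self-map of a minimal subspace moves no point further than
any other, and if it were not the identity its iterates would leave the bounded set. So the
projections between minimal subspaces compose, and the union of the minimal subspaces is a product
`C × T` with `T` a bounded closed convex transversal, isometric to the space of components. The
central component is the one through the circumcentre of `T`.

Now let `X` itself be minimal. The other factors commute with `G i`, so they move no point of the
closed convex hull of a `G i`-orbit further than the points of the orbit. By non-evanescence of the
product, the points of the hull of the `G i`-orbit of `x` that `G i` moves no further than `x` are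
therefore bounded, which is enough to foliate `X` by minimal `G i`-subspaces. Projecting to a leaf
splits off one factor, and this can be iterated. On the remainder after all factors have been split
off the whole group acts trivially, so by minimality the remainder is a point.
-/

namespace CatZero

section Midpoints

variable {X : Type*} [MetricSpace X]

theorem IsCAT0.exists_mid (hX : IsCAT0 X) (x y : X) :
    ∃ m, dist x m = dist x y / 2 ∧ dist y m = dist x y / 2 ∧
      ∀ z, 2 * dist m z ^ 2 ≤ dist x z ^ 2 + dist y z ^ 2 - dist x y ^ 2 / 2 := by
  obtain ⟨γ, hγ⟩ := hX.exists_geodesic x y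
  have hxy : 0 ≤ dist x y := dist_nonneg
  have hm : dist x y / 2 ∈ Set.Icc 0 (dist x y) := ⟨by linarith, by linarith⟩
  refine ⟨γ (dist x y / 2), ?_, ?_, fun z => ?_⟩
  · have h := hγ.isometry 0 ⟨le_rfl, hxy⟩ _ hm
    rwa [hγ.source, zero_sub, abs_neg, abs_of_nonneg hm.1] at h
  · have h := hγ.isometry (dist x y) ⟨hxy, le_rfl⟩ _ hm
    rwa [hγ.target, sub_half, abs_of_nonneg hm.1] at h
  · have h := hX.bruhat_tits z x y γ hγ
    rw [dist_comm y x] at h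
    linarith

/-- The midpoint of two points of a CAT(0) space, chosen from `IsCAT0.exists_mid`; it is unique by
`IsCAT0.eq_mid`. -/
noncomputable def IsCAT0.mid (hX : IsCAT0 X) (x y : X) : X := (hX.exists_mid x y).choose

variable (hX : IsCAT0 X)
include hX

theorem IsCAT0.dist_left_mid (x y : X) : dist x (hX.mid x y) = dist x y / 2 :=
  (hX.exists_mid x y).choose_spec.1

theorem IsCAT0.dist_right_mid (x y : X) : dist y (hX.mid x y) = dist x y / 2 :=
  (hX.exists_mid x y).choose_spec.2.1

theorem IsCAT0.dist_mid_sq_le (x y z : X) :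
    2 * dist (hX.mid x y) z ^ 2 ≤ dist x z ^ 2 + dist y z ^ 2 - dist x y ^ 2 / 2 :=
  (hX.exists_mid x y).choose_spec.2.2 z

theorem IsCAT0.eq_mid {x y m : X} (hx : dist x m ≤ dist x y / 2) (hy : dist y m ≤ dist x y / 2) :
    m = hX.mid x y := by
  have hm : dist (hX.mid x y) m ^ 2 ≤ 0 := by
    have hx2 := pow_le_pow_left₀ dist_nonneg hx 2
    have hy2 := pow_le_pow_left₀ dist_nonneg hy 2
    linarith [hX.dist_mid_sq_le x y m]
  exact (dist_eq_zero.1 (sq_nonpos_iff _ |>.1 hm)).symm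

theorem IsCAT0.mid_self (x : X) : hX.mid x x = x :=
  (hX.eq_mid (by simp) (by simp)).symm

theorem IsCAT0.mid_comm (x y : X) : hX.mid x y = hX.mid y x :=
  hX.eq_mid (by rw [hX.dist_right_mid, dist_comm]) (by rw [hX.dist_left_mid, dist_comm])

theorem IsCAT0.dist_mid_mid_left_le (x y z : X) :
    dist (hX.mid x y) (hX.mid x z) ≤ dist y z / 2 := by
  have hy := hX.dist_mid_sq_le x y (hX.mid x z)
  have hz := hX.dist_mid_sq_le x z y
  rw [hX.dist_left_mid, dist_comm y] at hy
  rw [dist_comm z y] at hz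
  exact le_of_sq_le_sq (by linarith) (by positivity)

theorem IsCAT0.dist_mid_mid_le (x y x' y' : X) :
    dist (hX.mid x y) (hX.mid x' y') ≤ (dist x x' + dist y y') / 2 := by
  have hy := hX.dist_mid_mid_left_le x y y'
  have hx := hX.dist_mid_mid_left_le y' x x'
  rw [hX.mid_comm y' x, hX.mid_comm y' x'] at hx
  linarith [dist_triangle (hX.mid x y) (hX.mid x y') (hX.mid x' y')]

theorem IsCAT0.dist_diagonals_sq_le (a b c d : X) :
    dist a c ^ 2 + dist b d ^ 2 ≤ dist a b ^ 2 + dist b c ^ 2 + dist c d ^ 2 + dist d a ^ 2 := by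
  have hb := hX.dist_mid_sq_le a c b
  have hd := hX.dist_mid_sq_le a c d
  have hbd := pow_le_pow_left₀ dist_nonneg (dist_triangle_left b d (hX.mid a c)) 2
  rw [dist_comm c b] at hb
  rw [dist_comm a d] at hd
  nlinarith [sq_nonneg (dist (hX.mid a c) b - dist (hX.mid a c) d)]

theorem IsCAT0.map_mid {Y : Type*} [MetricSpace Y] (hY : IsCAT0 Y) {f : X → Y} {x y : X}
    (hxy : dist (f x) (f y) = dist x y)
    (hx : dist (f x) (f (hX.mid x y)) ≤ dist x (hX.mid x y))
    (hy : dist (f y) (f (hX.mid x y)) ≤ dist y (hX.mid x y)) :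
    f (hX.mid x y) = hY.mid (f x) (f y) := by
  rw [hX.dist_left_mid] at hx
  rw [hX.dist_right_mid] at hy
  exact hY.eq_mid (by rwa [hxy]) (by rwa [hxy])

/- The Bruhat-Tits inequalities for the two coordinates of the midpoint add up to an equality, so
both defects vanish. -/
theorem IsCAT0.map_mid_of_dist_sq_eq_add {Y Z : Type*} [MetricSpace Y] [MetricSpace Z]
    (hY : IsCAT0 Y) (hZ : IsCAT0 Z) {f : X → Y} {g : X → Z}
    (h : ∀ x y, dist x y ^ 2 = dist (f x) (f y) ^ 2 + dist (g x) (g y) ^ 2) (x y : X) :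
    f (hX.mid x y) = hY.mid (f x) (f y) ∧ g (hX.mid x y) = hZ.mid (g x) (g y) := by
  set m := hX.mid x y
  have hx : dist x m ^ 2 = dist x y ^ 2 / 4 := by rw [hX.dist_left_mid]; ring
  have hy : dist y m ^ 2 = dist x y ^ 2 / 4 := by rw [hX.dist_right_mid]; ring
  have hf := hY.dist_mid_sq_le (f x) (f y) (f m)
  have hg := hZ.dist_mid_sq_le (g x) (g y) (g m)
  rw [h x m, h x y] at hx
  rw [h y m, h x y] at hy
  have hf' := sq_nonneg (dist (hY.mid (f x) (f y)) (f m))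
  have hg' := sq_nonneg (dist (hZ.mid (g x) (g y)) (g m))
  have hf0 : dist (hY.mid (f x) (f y)) (f m) ^ 2 ≤ 0 := by linarith
  have hg0 : dist (hZ.mid (g x) (g y)) (g m) ^ 2 ≤ 0 := by linarith
  exact ⟨(dist_eq_zero.1 (sq_nonpos_iff _ |>.1 hf0)).symm,
    (dist_eq_zero.1 (sq_nonpos_iff _ |>.1 hg0)).symm⟩

end Midpoints

section Convexity

variable {X : Type*} [MetricSpace X]

theorem Icc_subset_of_midpoint_mem {A : Set ℝ} (hA : IsClosed A)
    (hmid : ∀ s ∈ A, ∀ t ∈ A, (s + t) / 2 ∈ A) {a b : ℝ} (ha : a ∈ A) (hb : b ∈ A) :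
    Set.Icc a b ⊆ A := by
  intro t ht
  by_contra htA
  have hbelow : BddAbove (A ∩ Set.Iic t) := ⟨t, fun _ hs => hs.2⟩
  have habove : BddBelow (A ∩ Set.Ici t) := ⟨t, fun _ hs => hs.2⟩
  have hl := (hA.inter isClosed_Iic).csSup_mem ⟨a, ha, ht.1⟩ hbelow
  have hr := (hA.inter isClosed_Ici).csInf_mem ⟨b, hb, ht.2⟩ habove
  set l := sSup (A ∩ Set.Iic t)
  set r := sInf (A ∩ Set.Ici t)
  have hlt : l < t := lt_of_le_of_ne hl.2 fun h => htA (h ▸ hl.1)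
  have htr : t < r := lt_of_le_of_ne hr.2 fun h => htA (h ▸ hr.1)
  have hm : (l + r) / 2 ∈ A := hmid l hl.1 r hr.1
  rcases le_total ((l + r) / 2) t with hmt | hmt
  · linarith [le_csSup hbelow ⟨hm, hmt⟩]
  · linarith [csInf_le habove ⟨hm, hmt⟩]

theorem IsGeodesic.continuousOn {x y : X} {γ : ℝ → X} (hγ : IsGeodesic x y γ) :
    ContinuousOn γ (Set.Icc 0 (dist x y)) :=
  (LipschitzOnWith.of_dist_le_mul (K := 1) fun s hs t ht => by
    rw [hγ.isometry s hs t ht, Real.dist_eq, NNReal.coe_one, one_mul]).continuousOn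

theorem IsGeodesic.apply_midpoint {x y : X} {γ : ℝ → X} (hγ : IsGeodesic x y γ) (hX : IsCAT0 X)
    {s t : ℝ} (hs : s ∈ Set.Icc 0 (dist x y)) (ht : t ∈ Set.Icc 0 (dist x y)) :
    γ ((s + t) / 2) = hX.mid (γ s) (γ t) := by
  have hm : (s + t) / 2 ∈ Set.Icc 0 (dist x y) :=
    ⟨by linarith [hs.1, ht.1], by linarith [hs.2, ht.2]⟩
  have hhalf : |s - t| / 2 = |(s - t) / 2| := by rw [abs_div, abs_two]
  apply hX.eq_mid
  · rw [hγ.isometry _ hs _ hm, hγ.isometry _ hs _ ht, hhalf]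
    exact le_of_eq (by congr 1; ring)
  · rw [hγ.isometry _ ht _ hm, hγ.isometry _ hs _ ht, hhalf, abs_sub_comm]
    exact le_of_eq (by congr 1; ring)

theorem IsGeodConvex.mid_mem {C : Set X} (hC : IsGeodConvex C) (hX : IsCAT0 X) {x y : X}
    (hx : x ∈ C) (hy : y ∈ C) : hX.mid x y ∈ C := by
  obtain ⟨γ, hγ⟩ := hX.exists_geodesic x y
  have hxy : 0 ≤ dist x y := dist_nonneg
  have hm := hγ.apply_midpoint hX ⟨le_rfl, hxy⟩ ⟨hxy, le_rfl⟩
  rw [hγ.source, hγ.target] at hm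
  rw [← hm]
  exact hC x hx y hy γ hγ _ ⟨by linarith, by linarith⟩

theorem IsCAT0.isGeodConvex_of_mid_mem (hX : IsCAT0 X) {C : Set X} (hC : IsClosed C)
    (hmid : ∀ x ∈ C, ∀ y ∈ C, hX.mid x y ∈ C) : IsGeodConvex C := by
  intro x hx y hy γ hγ t ht
  have hxy : 0 ≤ dist x y := dist_nonneg
  have hclosed : IsClosed (Set.Icc 0 (dist x y) ∩ γ ⁻¹' C) :=
    hγ.continuousOn.preimage_isClosed_of_isClosed isClosed_Icc hC
  refine (Icc_subset_of_midpoint_mem hclosed ?_ ⟨⟨le_rfl, hxy⟩, ?_⟩ ⟨⟨hxy, le_rfl⟩, ?_⟩ ht).2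
  · rintro s ⟨hs, hsC⟩ t ⟨ht, htC⟩
    refine ⟨⟨by linarith [hs.1, ht.1], by linarith [hs.2, ht.2]⟩, ?_⟩
    rw [Set.mem_preimage, hγ.apply_midpoint hX hs ht]
    exact hmid _ hsC _ htC
  · rwa [Set.mem_preimage, hγ.source]
  · rwa [Set.mem_preimage, hγ.target]

/-- A non-empty closed convex subset: the subspaces onto which a complete CAT(0) space has a
nearest-point projection. -/
structure IsConvexSubspace (C : Set X) : Prop where
  nonempty : C.Nonempty
  isClosed : IsClosed C
  convex : IsGeodConvex C

theorem IsConvexSubspace.mid_mem {C : Set X} (hC : IsConvexSubspace C) (hX : IsCAT0 X) {x y : X}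
    (hx : x ∈ C) (hy : y ∈ C) : hX.mid x y ∈ C :=
  hC.convex.mid_mem hX hx hy

end Convexity

section Completeness

variable {X : Type*} [MetricSpace X] [CompleteSpace X]

theorem nonempty_iInter_of_directed_of_dist_lt {ι : Type*} [Nonempty ι] {s : ι → Set X}
    (hdir : Directed (· ⊇ ·) s) (hne : ∀ i, (s i).Nonempty) (hclosed : ∀ i, IsClosed (s i))
    (hsmall : ∀ ε > 0, ∃ i, ∀ x ∈ s i, ∀ y ∈ s i, dist x y < ε) : (⋂ i, s i).Nonempty := by
  have hbot : (⨅ i, Filter.principal (s i)).NeBot :=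
    Filter.iInf_neBot_of_directed'
      (fun i j => (hdir i j).imp fun _ hk =>
        ⟨Filter.principal_mono.2 hk.1, Filter.principal_mono.2 hk.2⟩)
      fun i => Filter.principal_neBot_iff.2 (hne i)
  have hmem (i : ι) : s i ∈ ⨅ i, Filter.principal (s i) :=
    Filter.mem_iInf_of_mem i (Filter.mem_principal_self _)
  have hcauchy : Cauchy (⨅ i, Filter.principal (s i)) :=
    Metric.cauchy_iff.2 ⟨hbot, fun ε hε =>
      let ⟨i, hi⟩ := hsmall ε hε
      ⟨s i, hmem i, hi⟩⟩
  obtain ⟨z, hz⟩ := CompleteSpace.complete hcauchy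
  refine ⟨z, Set.mem_iInter.2 fun i => isClosed_iff_clusterPt.1 (hclosed i) z ?_⟩
  exact hbot.mono (le_inf hz (Filter.le_principal_iff.2 (hmem i)))

variable (hX : IsCAT0 X) {C : Set X}
include hX

omit [CompleteSpace X] in
theorem IsConvexSubspace.add_dist_sq_le_of_isMinOn (hC : IsConvexSubspace C) {f : X → ℝ}
    (hf : ∀ x ∈ C, ∀ y ∈ C, f (hX.mid x y) ≤ (f x + f y) / 2 - dist x y ^ 2 / 4) {z : X}
    (hz : z ∈ C) (hmin : IsMinOn f C z) {x : X} (hx : x ∈ C) : f z + dist z x ^ 2 ≤ f x := by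
  have halving (k : ℕ) : ∀ x ∈ C, f z + (1 - (1 / 2) ^ k) * dist z x ^ 2 ≤ f x := by
    induction k with
    | zero => simpa using fun x hx => hmin hx
    | succ k ih =>
      intro x hx
      have hm := ih _ (hC.mid_mem hX hz hx)
      rw [hX.dist_left_mid] at hm
      rw [pow_succ]
      linarith [hf z hz x hx]
  have hlim : Filter.Tendsto (fun k : ℕ => f z + (1 - (1 / 2 : ℝ) ^ k) * dist z x ^ 2)
      Filter.atTop (nhds (f z + (1 - 0) * dist z x ^ 2)) :=
    ((tendsto_pow_atTop_nhds_zero_of_lt_one (by norm_num) (by norm_num)).const_sub 1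
      |>.mul_const _).const_add _
  simpa using le_of_tendsto' hlim fun k => halving k x hx

theorem IsConvexSubspace.exists_add_dist_sq_le (hC : IsConvexSubspace C) {f : X → ℝ}
    (hf : ∀ x ∈ C, ∀ y ∈ C, f (hX.mid x y) ≤ (f x + f y) / 2 - dist x y ^ 2 / 4)
    (hcont : ContinuousOn f C) (hbdd : BddBelow (f '' C)) :
    ∃ z ∈ C, ∀ x ∈ C, f z + dist z x ^ 2 ≤ f x := by
  set I := sInf (f '' C)
  have hI {x : X} (hx : x ∈ C) : I ≤ f x := csInf_le hbdd (Set.mem_image_of_mem f hx)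
  let s (ε : Set.Ioi (0 : ℝ)) : Set X := C ∩ f ⁻¹' Set.Iic (I + ε)
  have : Nonempty (Set.Ioi (0 : ℝ)) := ⟨1, Set.mem_Ioi.2 one_pos⟩
  have hanti : Monotone s := fun ε δ h x hx =>
    ⟨hx.1, hx.2.trans (add_le_add_right (Subtype.coe_le_coe.2 h) I)⟩
  have hne (ε : Set.Ioi (0 : ℝ)) : (s ε).Nonempty := by
    obtain ⟨_, ⟨x, hx, rfl⟩, hlt⟩ :=
      Real.lt_sInf_add_pos (hC.nonempty.image f) ε.2
    exact ⟨x, hx, hlt.le⟩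
  have hsmall (ε : ℝ) (hε : ε > 0) : ∃ δ, ∀ x ∈ s δ, ∀ y ∈ s δ, dist x y < ε := by
    refine ⟨⟨ε ^ 2 / 8, Set.mem_Ioi.2 (by positivity)⟩, fun x hx y hy => ?_⟩
    refine lt_of_pow_lt_pow_left₀ 2 hε.le ?_
    have hx' : f x ≤ I + ε ^ 2 / 8 := hx.2
    have hy' : f y ≤ I + ε ^ 2 / 8 := hy.2
    have := pow_pos hε 2
    linarith [hf x hx.1 y hy.1, hI (hC.mid_mem hX hx.1 hy.1)]
  obtain ⟨z, hz⟩ := nonempty_iInter_of_directed_of_dist_lt hanti.directed_ge hne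
    (fun ε => hcont.preimage_isClosed_of_isClosed hC.isClosed isClosed_Iic) hsmall
  rw [Set.mem_iInter] at hz
  have hzC : z ∈ C := (hz ⟨1, Set.mem_Ioi.2 one_pos⟩).1
  have hzI : f z ≤ I := le_of_forall_pos_le_add fun ε hε => (hz ⟨ε, hε⟩).2
  exact ⟨z, hzC, fun x hx =>
    hC.add_dist_sq_le_of_isMinOn hX hf hzC (fun y hy => hzI.trans (hI hy)) hx⟩

theorem IsConvexSubspace.exists_dist_sq_add_le (hC : IsConvexSubspace C) (x : X) :
    ∃ p ∈ C, ∀ c ∈ C, dist x p ^ 2 + dist p c ^ 2 ≤ dist x c ^ 2 := by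
  refine hC.exists_add_dist_sq_le hX (fun y _ z _ => ?_) (by fun_prop)
    ⟨0, Set.forall_mem_image.2 fun c _ => sq_nonneg _⟩
  have h := hX.dist_mid_sq_le y z x
  rw [dist_comm _ x, dist_comm _ x, dist_comm _ x] at h
  linarith

open Classical in
/-- The nearest-point projection to `C`; a point without a nearest point in `C` is its own
image. -/
noncomputable def proj (C : Set X) (x : X) : X :=
  if h : ∃ p ∈ C, dist x p = Metric.infDist x C then h.choose else x

theorem IsConvexSubspace.exists_dist_eq_infDist (hC : IsConvexSubspace C) (x : X) :
    ∃ p ∈ C, dist x p = Metric.infDist x C := by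
  obtain ⟨p, hp, hle⟩ := hC.exists_dist_sq_add_le hX x
  refine ⟨p, hp, le_antisymm ((Metric.le_infDist hC.nonempty).2 fun {c} hc => ?_)
    (Metric.infDist_le_dist_of_mem hp)⟩
  exact le_of_sq_le_sq (by linarith [hle c hc, sq_nonneg (dist p c)]) dist_nonneg

theorem IsConvexSubspace.proj_mem (hC : IsConvexSubspace C) (x : X) : proj C x ∈ C := by
  have h := hC.exists_dist_eq_infDist hX x
  rw [proj, dif_pos h]
  exact h.choose_spec.1

theorem IsConvexSubspace.dist_proj (hC : IsConvexSubspace C) (x : X) :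
    dist x (proj C x) = Metric.infDist x C := by
  have h := hC.exists_dist_eq_infDist hX x
  rw [proj, dif_pos h]
  exact h.choose_spec.2

theorem IsConvexSubspace.infDist_sq_add_dist_sq_le (hC : IsConvexSubspace C) (x : X) {c : X}
    (hc : c ∈ C) : Metric.infDist x C ^ 2 + dist (proj C x) c ^ 2 ≤ dist x c ^ 2 := by
  obtain ⟨p, hp, hle⟩ := hC.exists_dist_sq_add_le hX x
  have hxp := Metric.infDist_le_dist_of_mem (x := x) hp
  have hproj : p = proj C x := by
    have h := hle _ (hC.proj_mem hX x)
    rw [hC.dist_proj hX] at h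
    have := pow_le_pow_left₀ Metric.infDist_nonneg hxp 2
    exact dist_eq_zero.1 (sq_nonpos_iff _ |>.1 (by linarith))
  rw [← hC.dist_proj hX, ← hproj]
  exact hle c hc

theorem IsConvexSubspace.eq_proj (hC : IsConvexSubspace C) {x p : X} (hp : p ∈ C)
    (hle : dist x p ≤ Metric.infDist x C) : p = proj C x := by
  have h := hC.infDist_sq_add_dist_sq_le hX x hp
  have hle2 := pow_le_pow_left₀ dist_nonneg hle 2
  exact (dist_eq_zero.1 (sq_nonpos_iff _ |>.1 (by linarith))).symm

theorem IsConvexSubspace.dist_proj_proj_le (hC : IsConvexSubspace C) (x y : X) :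
    dist (proj C x) (proj C y) ≤ dist x y := by
  have hx := hC.infDist_sq_add_dist_sq_le hX x (hC.proj_mem hX y)
  have hy := hC.infDist_sq_add_dist_sq_le hX y (hC.proj_mem hX x)
  have hxy := hX.dist_diagonals_sq_le x (proj C x) (proj C y) y
  rw [dist_comm (proj C y) (proj C x)] at hy
  rw [dist_comm (proj C x) y, dist_comm (proj C y) y, hC.dist_proj hX, hC.dist_proj hX,
    dist_comm y x] at hxy
  exact le_of_sq_le_sq (by linarith) dist_nonneg

theorem IsConvexSubspace.continuous_proj (hC : IsConvexSubspace C) : Continuous (proj C) :=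
  (LipschitzWith.of_dist_le_mul (K := 1) fun x y => by
    simpa using hC.dist_proj_proj_le hX x y).continuous

theorem IsConvexSubspace.infDist_mid_le (hC : IsConvexSubspace C) (x y : X) :
    Metric.infDist (hX.mid x y) C ≤ (Metric.infDist x C + Metric.infDist y C) / 2 := by
  rw [← hC.dist_proj hX x, ← hC.dist_proj hX y]
  exact (Metric.infDist_le_dist_of_mem (hC.mid_mem hX (hC.proj_mem hX x) (hC.proj_mem hX y))).trans
    (hX.dist_mid_mid_le _ _ _ _)

theorem nonempty_sInter_of_directedOn_of_infDist_le {𝒟 : Set (Set X)} (hne : 𝒟.Nonempty)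
    (hdir : DirectedOn (· ⊇ ·) 𝒟) (hconv : ∀ D ∈ 𝒟, IsConvexSubspace D) {x : X} {R : ℝ}
    (hR : ∀ D ∈ 𝒟, Metric.infDist x D ≤ R) : (⋂₀ 𝒟).Nonempty := by
  set r := sSup ((fun D => Metric.infDist x D ^ 2) '' 𝒟)
  have hr (D : 𝒟) : Metric.infDist x D ^ 2 ≤ r := le_csSup ⟨R ^ 2, Set.forall_mem_image.2
    fun D hD => pow_le_pow_left₀ Metric.infDist_nonneg (hR D hD) 2⟩ (Set.mem_image_of_mem _ D.2)
  let s (D : 𝒟) : Set X := D ∩ {c | dist x c ^ 2 ≤ r}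
  have hs : Directed (· ⊇ ·) s := fun D E => by
    obtain ⟨F, hF, hFD, hFE⟩ := hdir D D.2 E E.2
    exact ⟨⟨F, hF⟩, Set.inter_subset_inter_left _ hFD, Set.inter_subset_inter_left _ hFE⟩
  have hs_ne (D : 𝒟) : (s D).Nonempty := by
    refine ⟨_, (hconv D D.2).proj_mem hX x, ?_⟩
    change dist x _ ^ 2 ≤ r
    rw [(hconv D D.2).dist_proj hX]
    exact hr D
  have hs_closed (D : 𝒟) : IsClosed (s D) :=
    (hconv D D.2).isClosed.inter (isClosed_le (by fun_prop) continuous_const)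
  have hsmall (ε : ℝ) (hε : ε > 0) : ∃ D, ∀ a ∈ s D, ∀ b ∈ s D, dist a b < ε := by
    have hε2 := pow_pos hε 2
    obtain ⟨_, ⟨D, hD, rfl⟩, hlt⟩ :=
      exists_lt_of_lt_csSup (hne.image _) (show r - ε ^ 2 / 8 < r by linarith)
    refine ⟨⟨D, hD⟩, fun a ha b hb => lt_of_pow_lt_pow_left₀ 2 hε.le ?_⟩
    have hm := pow_le_pow_left₀ Metric.infDist_nonneg
      (Metric.infDist_le_dist_of_mem (x := x) ((hconv D hD).mid_mem hX ha.1 hb.1)) 2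
    have ha : dist x a ^ 2 ≤ r := ha.2
    have hb : dist x b ^ 2 ≤ r := hb.2
    rw [dist_comm] at hm ha hb
    linarith [hX.dist_mid_sq_le a b x]
  have : Nonempty 𝒟 := hne.to_subtype
  rw [Set.sInter_eq_iInter]
  exact (nonempty_iInter_of_directed_of_dist_lt hs hs_ne hs_closed hsmall).mono
    (Set.iInter_mono fun D => Set.inter_subset_left)

end Completeness

section Radius

variable {X : Type*} [MetricSpace X]

/-- The smallest radius of a closed ball around `x` that contains `A`. It is meant for bounded `A`:
for unbounded `A` the supremum is `0`. -/
noncomputable def radiusAt (A : Set X) (x : X) : ℝ := ⨆ y : A, dist x y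

theorem radiusAt_le {A : Set X} {x : X} {r : ℝ} (hr : 0 ≤ r) (h : ∀ y ∈ A, dist x y ≤ r) :
    radiusAt A x ≤ r :=
  Real.iSup_le (fun y => h y y.2) hr

theorem dist_le_radiusAt {A : Set X} (hA : Bornology.IsBounded A) (x : X) {y : X} (hy : y ∈ A) :
    dist x y ≤ radiusAt A x := by
  obtain ⟨r, hr⟩ := (Metric.isBounded_iff_subset_closedBall x).1 hA
  refine le_ciSup (f := fun y : A => dist x y) ⟨r, Set.forall_mem_range.2 fun z => ?_⟩ ⟨y, hy⟩
  rw [dist_comm]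
  exact hr z.2

theorem radiusAt_nonneg (A : Set X) (x : X) : 0 ≤ radiusAt A x :=
  Real.iSup_nonneg fun _ => dist_nonneg

theorem continuous_radiusAt {A : Set X} (hA : Bornology.IsBounded A) : Continuous (radiusAt A) :=
  (LipschitzWith.of_le_add fun x y =>
    radiusAt_le (add_nonneg (radiusAt_nonneg A y) dist_nonneg) fun a ha => by
      linarith [dist_triangle x y a, dist_le_radiusAt hA y ha]).continuous

theorem IsCAT0.radiusAt_mid_sq_le (hX : IsCAT0 X) {A : Set X} (hA : Bornology.IsBounded A)
    (hne : A.Nonempty) (x y : X) : radiusAt A (hX.mid x y) ^ 2 ≤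
      (radiusAt A x ^ 2 + radiusAt A y ^ 2) / 2 - dist x y ^ 2 / 4 := by
  have hle {a : X} (ha : a ∈ A) : dist (hX.mid x y) a ^ 2 ≤
      (radiusAt A x ^ 2 + radiusAt A y ^ 2) / 2 - dist x y ^ 2 / 4 := by
    have hx := pow_le_pow_left₀ dist_nonneg (dist_le_radiusAt hA x ha) 2
    have hy := pow_le_pow_left₀ dist_nonneg (dist_le_radiusAt hA y ha) 2
    linarith [hX.dist_mid_sq_le x y a]
  obtain ⟨a, ha⟩ := hne
  refine (Real.le_sqrt (radiusAt_nonneg _ _) ((sq_nonneg _).trans (hle ha))).1 ?_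
  exact radiusAt_le (Real.sqrt_nonneg _) fun y hy => Real.le_sqrt_of_sq_le (hle hy)

theorem IsConvexSubspace.exists_radiusAt_sq_add_dist_sq_le [CompleteSpace X] (hX : IsCAT0 X)
    {C A : Set X} (hC : IsConvexSubspace C) (hA : Bornology.IsBounded A) (hne : A.Nonempty) :
    ∃ z ∈ C, ∀ x ∈ C, radiusAt A z ^ 2 + dist z x ^ 2 ≤ radiusAt A x ^ 2 :=
  hC.exists_add_dist_sq_le hX (fun x _ y _ => hX.radiusAt_mid_sq_le hA hne x y)
    ((continuous_radiusAt hA).pow 2).continuousOn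
    ⟨0, Set.forall_mem_image.2 fun _ _ => sq_nonneg _⟩

end Radius

section Invariant

variable {H K X Y : Type*} [Group H] [Group K] [MetricSpace X] [MetricSpace Y]
  [MulAction H X] [MulAction K Y] {C C' : Set X}

theorem IsInvariantSubspace.isConvexSubspace (hC : IsInvariantSubspace H C) :
    IsConvexSubspace C :=
  ⟨hC.nonempty, hC.isClosed, hC.convex⟩

theorem IsMinimalSubspace.isConvexSubspace (hC : IsMinimalSubspace H C) : IsConvexSubspace C :=
  hC.1.isConvexSubspace

theorem IsInvariantSubspace.sInter {𝒟 : Set (Set X)} (h : ∀ D ∈ 𝒟, IsInvariantSubspace H D)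
    (hne : (⋂₀ 𝒟).Nonempty) : IsInvariantSubspace H (⋂₀ 𝒟) where
  nonempty := hne
  isClosed := isClosed_sInter fun D hD => (h D hD).isClosed
  convex x hx y hy γ hγ t ht D hD := (h D hD).convex x (hx D hD) y (hy D hD) γ hγ t ht
  smul_mem g x hx D hD := (h D hD).smul_mem g x (hx D hD)

variable (H) in
/-- The smallest closed convex invariant subspace containing `x`. -/
def orbitHull (x : X) : Set X := ⋂₀ {C | IsInvariantSubspace H C ∧ x ∈ C}

theorem mem_orbitHull (x : X) : x ∈ orbitHull H x := fun _ hC => hC.2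

theorem isInvariantSubspace_orbitHull (x : X) : IsInvariantSubspace H (orbitHull H x) :=
  .sInter (fun _ hC => hC.1) ⟨x, mem_orbitHull x⟩

theorem IsInvariantSubspace.orbitHull_subset (hC : IsInvariantSubspace H C) {x : X} (hx : x ∈ C) :
    orbitHull H x ⊆ C :=
  Set.sInter_subset_of_mem ⟨hC, hx⟩

theorem IsMinimalSubspace.orbitHull_eq (hC : IsMinimalSubspace H C) {x : X} (hx : x ∈ C) :
    orbitHull H x = C :=
  (hC.1.orbitHull_subset hx).antisymm
    (hC.2 (isInvariantSubspace_orbitHull x) (hC.1.orbitHull_subset hx))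

theorem IsMinimalSubspace.eq_of_mem (hC : IsMinimalSubspace H C) (hC' : IsMinimalSubspace H C')
    {x : X} (hx : x ∈ C) (hx' : x ∈ C') : C = C' :=
  (hC.orbitHull_eq hx).symm.trans (hC'.orbitHull_eq hx')

theorem IsCAT0.isInvariantSubspace (hX : IsCAT0 X) (hne : C.Nonempty) (hclosed : IsClosed C)
    (hmid : ∀ x ∈ C, ∀ y ∈ C, hX.mid x y ∈ C) (hsmul : ∀ h : H, ∀ x ∈ C, h • x ∈ C) :
    IsInvariantSubspace H C :=
  ⟨hne, hclosed, hX.isGeodConvex_of_mid_mem hclosed hmid, hsmul⟩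

theorem IsMinimalSubspace.eq_of_convex (hC : IsMinimalSubspace H C) (hX : IsCAT0 X) {f : X → ℝ}
    (hcont : ContinuousOn f C) (hconv : ∀ x ∈ C, ∀ y ∈ C, f (hX.mid x y) ≤ (f x + f y) / 2)
    (hinv : ∀ h : H, ∀ x ∈ C, f (h • x) = f x) {x y : X} (hx : x ∈ C) (hy : y ∈ C) :
    f x = f y := by
  have hle {x y : X} (hx : x ∈ C) (hy : y ∈ C) : f x ≤ f y := by
    have hsub : IsInvariantSubspace H (C ∩ f ⁻¹' Set.Iic (f y)) := by
      refine hX.isInvariantSubspace ⟨y, hy, le_refl (f y)⟩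
        (hcont.preimage_isClosed_of_isClosed hC.1.isClosed isClosed_Iic) ?_ ?_
      · rintro a ⟨ha, ha' : f a ≤ f y⟩ b ⟨hb, hb' : f b ≤ f y⟩
        exact ⟨hC.1.convex.mid_mem hX ha hb, (hconv a ha b hb).trans (by linarith)⟩
      · exact fun h a ⟨ha, ha'⟩ => ⟨hC.1.smul_mem h a ha, (hinv h a ha).trans_le ha'⟩
    exact (hC.2 hsub Set.inter_subset_left hx).2
  exact le_antisymm (hle hx hy) (hle hy hx)

/-- The restriction of `f` to `C` is an isometric embedding that is equivariant along the map `ψ`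
of acting groups. -/
structure IsEquivIsomOn (ψ : H → K) (C : Set X) (f : X → Y) : Prop where
  dist_eq : ∀ x ∈ C, ∀ y ∈ C, dist (f x) (f y) = dist x y
  map_smul : ∀ h : H, ∀ x ∈ C, f (h • x) = ψ h • f x

theorem IsEquivIsomOn.comp {L Z : Type*} [Group L] [MetricSpace Z] [MulAction L Z] {χ : K → L}
    {ψ : H → K} {D : Set Y} {g : Y → Z} {f : X → Y} (hg : IsEquivIsomOn χ D g)
    (hf : IsEquivIsomOn ψ C f) (hmaps : Set.MapsTo f C D) :
    IsEquivIsomOn (χ ∘ ψ) C (g ∘ f) where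
  dist_eq x hx y hy := (hg.dist_eq _ (hmaps hx) _ (hmaps hy)).trans (hf.dist_eq x hx y hy)
  map_smul h x hx := by
    rw [Function.comp_apply, hf.map_smul h x hx, hg.map_smul _ _ (hmaps hx)]
    rfl

theorem IsEquivIsomOn.mono {ψ : H → K} {f : X → Y} (hf : IsEquivIsomOn ψ C f) (h : C' ⊆ C) :
    IsEquivIsomOn ψ C' f :=
  ⟨fun x hx y hy => hf.dist_eq x (h hx) y (h hy), fun g x hx => hf.map_smul g x (h hx)⟩

theorem IsEquivIsomOn.iterate {f : X → X} (hf : IsEquivIsomOn (id : H → H) C f)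
    (hmaps : Set.MapsTo f C C) (k : ℕ) : IsEquivIsomOn (id : H → H) C f^[k] := by
  induction k with
  | zero => exact ⟨fun _ _ _ _ => rfl, fun _ _ _ => rfl⟩
  | succ k ih => exact ih.comp hf hmaps

theorem IsEquivIsomOn.continuousOn {ψ : H → K} {f : X → Y} (hf : IsEquivIsomOn ψ C f) :
    ContinuousOn f C :=
  (LipschitzOnWith.of_dist_le_mul (K := 1) fun x hx y hy => by
    simp [hf.dist_eq x hx y hy]).continuousOn

theorem IsEquivIsomOn.of_tendsto [ContinuousConstSMul K Y] {ι : Type*} {l : Filter ι} [l.NeBot]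
    {ψ : H → K} {g : ι → X → Y} {f : X → Y} (hC : IsInvariantSubspace H C)
    (hg : ∀ i, IsEquivIsomOn ψ C (g i))
    (hlim : ∀ x ∈ C, Filter.Tendsto (g · x) l (nhds (f x))) : IsEquivIsomOn ψ C f where
  dist_eq x hx y hy := by
    refine tendsto_nhds_unique ((hlim x hx).dist (hlim y hy)) ?_
    simp only [(hg _).dist_eq x hx y hy, tendsto_const_nhds]
  map_smul h x hx := by
    refine tendsto_nhds_unique (hlim _ (hC.smul_mem h x hx)) ?_
    simp only [(hg _).map_smul h x hx]
    exact (hlim x hx).const_smul (ψ h)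

theorem IsEquivIsomOn.map_mid {ψ : H → K} {f : X → Y} (hf : IsEquivIsomOn ψ C f)
    (hC : IsGeodConvex C) (hX : IsCAT0 X) (hY : IsCAT0 Y) {x y : X} (hx : x ∈ C) (hy : y ∈ C) :
    f (hX.mid x y) = hY.mid (f x) (f y) :=
  have hm := hC.mid_mem hX hx hy
  hX.map_mid hY (hf.dist_eq x hx y hy) (hf.dist_eq x hx _ hm).le (hf.dist_eq y hy _ hm).le

theorem IsInvariantSubspace.image [CompleteSpace X] (hC : IsInvariantSubspace H C) (hX : IsCAT0 X)
    (hY : IsCAT0 Y) {ψ : H → K} (hψ : Function.Surjective ψ) {f : X → Y}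
    (hf : IsEquivIsomOn ψ C f) : IsInvariantSubspace K (f '' C) := by
  refine hY.isInvariantSubspace (hC.nonempty.image f) ?_ ?_ ?_
  · have hiso : Isometry (C.domRestrict f) :=
      Isometry.of_dist_eq fun x y => hf.dist_eq x x.2 y y.2
    have : CompleteSpace C := hC.isClosed.completeSpace_coe
    rw [← Set.range_domRestrict]
    exact hiso.isClosedEmbedding.isClosed_range
  · rintro _ ⟨x, hx, rfl⟩ _ ⟨y, hy, rfl⟩
    exact ⟨_, hC.convex.mid_mem hX hx hy, hf.map_mid hC.convex hX hY hx hy⟩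
  · rintro k _ ⟨x, hx, rfl⟩
    obtain ⟨h, rfl⟩ := hψ k
    exact ⟨h • x, hC.smul_mem h x hx, hf.map_smul h x hx⟩

theorem IsMinimalSubspace.image [CompleteSpace X] (hC : IsMinimalSubspace H C) (hX : IsCAT0 X)
    (hY : IsCAT0 Y) {ψ : H → K} (hψ : Function.Surjective ψ) {f : X → Y}
    (hf : IsEquivIsomOn ψ C f) : IsMinimalSubspace K (f '' C) := by
  refine ⟨hC.1.image hX hY hψ hf, fun D hD hDC => ?_⟩
  have hsub : IsInvariantSubspace H (C ∩ f ⁻¹' D) := by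
    refine hX.isInvariantSubspace ?_
      (hf.continuousOn.preimage_isClosed_of_isClosed hC.1.isClosed hD.isClosed) ?_ ?_
    · obtain ⟨y, hy⟩ := hD.nonempty
      obtain ⟨x, hx, rfl⟩ := hDC hy
      exact ⟨x, hx, hy⟩
    · rintro a ⟨ha, ha'⟩ b ⟨hb, hb'⟩
      refine ⟨hC.1.convex.mid_mem hX ha hb, ?_⟩
      rw [Set.mem_preimage, hf.map_mid hC.1.convex hX hY ha hb]
      exact hD.convex.mid_mem hY ha' hb'
    · rintro h a ⟨ha, ha'⟩
      refine ⟨hC.1.smul_mem h a ha, ?_⟩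
      rw [Set.mem_preimage, hf.map_smul h a ha]
      exact hD.smul_mem _ _ ha'
  exact Set.image_subset_iff.2 ((hC.2 hsub Set.inter_subset_left).trans Set.inter_subset_right)

variable [IsIsometricSMul H X]

theorem IsCAT0.smul_mid (hX : IsCAT0 X) (h : H) (x y : X) :
    h • hX.mid x y = hX.mid (h • x) (h • y) :=
  hX.map_mid hX (f := (h • ·)) (dist_smul _ _ _) (dist_smul _ _ _).le (dist_smul _ _ _).le

theorem IsInvariantSubspace.infDist_smul (hC : IsInvariantSubspace H C) (h : H) (x : X) :
    Metric.infDist (h • x) C = Metric.infDist x C := by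
  have himage : (h • ·) '' C = C :=
    (Set.image_subset_iff.2 (hC.smul_mem h)).antisymm fun x hx =>
      ⟨h⁻¹ • x, hC.smul_mem h⁻¹ x hx, smul_inv_smul h x⟩
  conv_lhs => rw [← himage]
  exact Metric.infDist_image (isometry_smul X h)

variable [CompleteSpace X]

theorem IsInvariantSubspace.proj_smul (hC : IsInvariantSubspace H C) (hX : IsCAT0 X) (h : H)
    (x : X) : proj C (h • x) = h • proj C x := by
  refine (hC.isConvexSubspace.eq_proj hX
    (hC.smul_mem h _ (hC.isConvexSubspace.proj_mem hX x)) ?_).symm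
  rw [dist_smul, hC.isConvexSubspace.dist_proj hX, hC.infDist_smul]

variable (H) in
/-- The points that no element of `H` displaces more than it displaces `x`. -/
def subDisplacement (x : X) : Set X := {t | ∀ h : H, dist (h • t) t ≤ dist (h • x) x}

theorem IsInvariantSubspace.proj_mem_subDisplacement (hC : IsInvariantSubspace H C)
    (hX : IsCAT0 X) (x : X) : proj C x ∈ subDisplacement H x := fun h => by
  rw [← hC.proj_smul hX]
  exact hC.isConvexSubspace.dist_proj_proj_le hX _ _

variable (H X) in
/-- The consequence of non-evanescence from which the existence and the rigidity of minimal
subspaces are deduced. Unlike non-evanescence, it passes to the factors of a product group acting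
on a minimal subspace. -/
def IsTame : Prop := ∀ x : X, Bornology.IsBounded (subDisplacement H x ∩ orbitHull H x)

theorem IsTame.exists_isMinimalSubspace (hT : IsTame H X) (hX : IsCAT0 X) (x : X) :
    ∃ C : Set X, IsMinimalSubspace H C := by
  obtain ⟨R, hR⟩ := (hT x).subset_closedBall x
  set S : Set (Set X) := {C | IsInvariantSubspace H C ∧ C ⊆ orbitHull H x}
  have hinfDist (D : Set X) (hD : D ∈ S) : Metric.infDist x D ≤ R := by
    have h := hR ⟨hD.1.proj_mem_subDisplacement hX x,
      hD.2 (hD.1.isConvexSubspace.proj_mem hX x)⟩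
    rwa [Metric.mem_closedBall, dist_comm, hD.1.isConvexSubspace.dist_proj hX] at h
  have hchain (c : Set (Set X)) (hcS : c ⊆ S) (hc : IsChain (· ⊆ ·) c) (hne : c.Nonempty) :
      ∃ D ∈ S, ∀ E ∈ c, D ⊆ E := by
    have hdir : DirectedOn (· ⊇ ·) c := fun D hD E hE => (hc.total hD hE).elim
      (fun h => ⟨D, hD, subset_rfl, h⟩) fun h => ⟨E, hE, h, subset_rfl⟩
    have hinter : (⋂₀ c).Nonempty := nonempty_sInter_of_directedOn_of_infDist_le hX hne hdir
      (fun D hD => (hcS hD).1.isConvexSubspace) fun D hD => hinfDist D (hcS hD)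
    exact ⟨⋂₀ c, ⟨.sInter (fun D hD => (hcS hD).1) hinter,
      (Set.sInter_subset_of_mem hne.some_mem).trans (hcS hne.some_mem).2⟩,
      fun D hD => Set.sInter_subset_of_mem hD⟩
  obtain ⟨C, -, hC⟩ := zorn_superset_nonempty S hchain _
    ⟨isInvariantSubspace_orbitHull x, subset_rfl⟩
  exact ⟨C, hC.1.1, fun D hD hDC => hC.2 ⟨hD, hDC.trans hC.1.2⟩ hDC⟩

end Invariant

section Parallel

variable {H X : Type*} [Group H] [MetricSpace X] [MulAction H X] [IsIsometricSMul H X]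
  [CompleteSpace X] {C C' : Set X}

theorem IsMinimalSubspace.infDist_eq (hC : IsMinimalSubspace H C)
    (hC' : IsInvariantSubspace H C') (hX : IsCAT0 X) {x y : X} (hx : x ∈ C) (hy : y ∈ C) :
    Metric.infDist x C' = Metric.infDist y C' :=
  hC.eq_of_convex hX (Metric.continuous_infDist_pt C').continuousOn
    (fun a _ b _ => hC'.isConvexSubspace.infDist_mid_le hX a b)
    (fun h a _ => hC'.infDist_smul h a) hx hy

theorem IsMinimalSubspace.setDist_eq_infDist (hC : IsMinimalSubspace H C)
    (hC' : IsInvariantSubspace H C') (hX : IsCAT0 X) {x : X} (hx : x ∈ C) :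
    setDist C C' = Metric.infDist x C' := by
  refine IsLeast.csInf_eq ⟨⟨x, hx, _, hC'.isConvexSubspace.proj_mem hX x,
    (hC'.isConvexSubspace.dist_proj hX x).symm⟩, ?_⟩
  rintro _ ⟨y, hy, z, hz, rfl⟩
  rw [hC.infDist_eq hC' hX hx hy]
  exact Metric.infDist_le_dist_of_mem hz

variable (hC : IsMinimalSubspace H C) (hC' : IsMinimalSubspace H C') (hX : IsCAT0 X)
include hC hC' hX

theorem IsMinimalSubspace.proj_proj {x : X} (hx : x ∈ C) : proj C (proj C' x) = x := by
  have hp := hC.isConvexSubspace.proj_mem hX (proj C' x)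
  refine (hC.isConvexSubspace.eq_proj hX hx ?_).symm
  calc dist (proj C' x) x = Metric.infDist x C' := by
        rw [dist_comm, hC'.isConvexSubspace.dist_proj hX]
    _ = Metric.infDist (proj C (proj C' x)) C' := hC.infDist_eq hC'.1 hX hx hp
    _ ≤ dist (proj C (proj C' x)) (proj C' x) :=
        Metric.infDist_le_dist_of_mem (hC'.isConvexSubspace.proj_mem hX x)
    _ = Metric.infDist (proj C' x) C := by rw [dist_comm, hC.isConvexSubspace.dist_proj hX]

theorem IsMinimalSubspace.isEquivIsomOn_proj : IsEquivIsomOn (id : H → H) C (proj C') where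
  dist_eq x hx y hy := by
    refine le_antisymm (hC'.isConvexSubspace.dist_proj_proj_le hX x y) ?_
    have h := hC.isConvexSubspace.dist_proj_proj_le hX (proj C' x) (proj C' y)
    rwa [hC.proj_proj hC' hX hx, hC.proj_proj hC' hX hy] at h
  map_smul h x _ := hC'.1.proj_smul hX h x

theorem IsMinimalSubspace.infDist_comm {x y : X} (hx : x ∈ C) (hy : y ∈ C') :
    Metric.infDist x C' = Metric.infDist y C := by
  rw [hC'.infDist_eq hC.1 hX hy (hC'.isConvexSubspace.proj_mem hX x),
    ← hC.isConvexSubspace.dist_proj hX, hC.proj_proj hC' hX hx, dist_comm,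
    hC'.isConvexSubspace.dist_proj hX]

theorem IsMinimalSubspace.dist_sq_eq {x y : X} (hx : x ∈ C) (hy : y ∈ C') :
    dist x y ^ 2 = dist (proj C' x) y ^ 2 + Metric.infDist x C' ^ 2 := by
  have hx' := hC'.isConvexSubspace.proj_mem hX x
  have hy' := hC.isConvexSubspace.proj_mem hX y
  have hlower := hC'.isConvexSubspace.infDist_sq_add_dist_sq_le hX x hy
  have hdiag := hC'.isConvexSubspace.infDist_sq_add_dist_sq_le hX (proj C y) hx'
  have hquad := hX.dist_diagonals_sq_le x (proj C' x) y (proj C y)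
  have hproj := (hC'.isEquivIsomOn_proj hC hX).dist_eq _ hx' _ hy
  rw [hC.proj_proj hC' hX hx] at hproj
  rw [hC'.proj_proj hC hX hy, ← hC.infDist_eq hC'.1 hX hx hy', dist_comm (proj C y),
    dist_comm y] at hdiag
  rw [hC'.isConvexSubspace.dist_proj hX, hC.isConvexSubspace.dist_proj hX,
    ← hC.infDist_comm hC' hX hx hy, dist_comm (proj C y) x, hproj] at hquad
  linarith

theorem IsMinimalSubspace.proj_mid_proj {x : X} (hx : x ∈ C) :
    proj C (hX.mid x (proj C' x)) = x := by
  have hp := hC'.isConvexSubspace.proj_mem hX x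
  refine (hC.isConvexSubspace.eq_proj hX hx ?_).symm
  have hlip := Metric.infDist_le_infDist_add_dist (s := C) (x := proj C' x)
    (y := hX.mid x (proj C' x))
  rw [← hC.infDist_comm hC' hX hx hp, hX.dist_right_mid, hC'.isConvexSubspace.dist_proj hX] at hlip
  rw [dist_comm, hX.dist_left_mid, hC'.isConvexSubspace.dist_proj hX]
  linarith

theorem IsMinimalSubspace.isEquivIsomOn_mid_proj :
    IsEquivIsomOn (id : H → H) C fun x => hX.mid x (proj C' x) where
  dist_eq x hx y hy := by
    apply le_antisymm
    · have h := hX.dist_mid_mid_le x (proj C' x) y (proj C' y)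
      rw [(hC.isEquivIsomOn_proj hC' hX).dist_eq x hx y hy] at h
      linarith
    · have h := hC.isConvexSubspace.dist_proj_proj_le hX (hX.mid x (proj C' x))
        (hX.mid y (proj C' y))
      rwa [hC.proj_mid_proj hC' hX hx, hC.proj_mid_proj hC' hX hy] at h
  map_smul h x _ := by rw [hC'.1.proj_smul hX, id, hX.smul_mid]

theorem IsMinimalSubspace.image_mid_proj :
    IsMinimalSubspace H ((fun x => hX.mid x (proj C' x)) '' C) :=
  hC.image hX hX Function.surjective_id (hC.isEquivIsomOn_mid_proj hC' hX)

theorem IsMinimalSubspace.dist_mid_proj_sq {x y : X} (hx : x ∈ C) (hy : y ∈ C) :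
    dist (hX.mid x (proj C' x)) y ^ 2 = dist x y ^ 2 + (Metric.infDist x C' / 2) ^ 2 := by
  have h := (hC.image_mid_proj hC' hX).dist_sq_eq hC hX (Set.mem_image_of_mem _ hx) hy
  rwa [← hC.isConvexSubspace.dist_proj hX, hC.proj_mid_proj hC' hX hx, dist_comm _ x,
    hX.dist_left_mid, hC'.isConvexSubspace.dist_proj hX] at h

theorem IsMinimalSubspace.exists_mid_mem {x y : X} (hx : x ∈ C) (hy : y ∈ C') :
    ∃ D, IsMinimalSubspace H D ∧ hX.mid x y ∈ D := by
  set q := hX.mid x (proj C y)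
  set δ := Metric.infDist y C
  have hyC := hC.isConvexSubspace.proj_mem hX y
  have hq : q ∈ C := hC.isConvexSubspace.mid_mem hX hx hyC
  have hq' := hC'.isConvexSubspace.proj_mem hX q
  have hpyth : dist x y ^ 2 = dist x (proj C y) ^ 2 + δ ^ 2 := by
    rw [dist_comm x, dist_comm x]
    exact hC'.dist_sq_eq hC hX hy hx
  have hxm : dist (hX.mid q (proj C' q)) x ^ 2 = (dist x y / 2) ^ 2 := by
    rw [hC.dist_mid_proj_sq hC' hX hq hx, dist_comm q, hX.dist_left_mid,
      hC.infDist_comm hC' hX hq hy]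
    linarith
  have hqy : dist (proj C' q) y = dist x (proj C y) / 2 := by
    have h := (hC.isEquivIsomOn_proj hC' hX).dist_eq q hq _ hyC
    rwa [hC'.proj_proj hC hX hy, dist_comm q, hX.dist_right_mid] at h
  have hym : dist (hX.mid q (proj C' q)) y ^ 2 = (dist x y / 2) ^ 2 := by
    have h := hC'.dist_mid_proj_sq hC hX hq' hy
    rw [hC.proj_proj hC' hX hq, hX.mid_comm, hqy, hC'.infDist_eq hC.1 hX hq' hy] at h
    linarith
  refine ⟨_, hC.image_mid_proj hC' hX, q, hq, hX.eq_mid ?_ ?_⟩ <;>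
    refine le_of_sq_le_sq ?_ (by positivity) <;> rw [dist_comm]
  exacts [hxm.le, hym.le]

end Parallel

section Rigidity

variable {H X : Type*} [Group H] [MetricSpace X] [MulAction H X] {C C₀ C' : Set X}

theorem IsEquivIsomOn.mem_subDisplacement {f : X → X} (hf : IsEquivIsomOn (id : H → H) C f)
    (hC : IsInvariantSubspace H C) {x : X} (hx : x ∈ C) : f x ∈ subDisplacement H x := fun h => by
  rw [← id_eq h, ← hf.map_smul h x hx, id, hf.dist_eq _ (hC.smul_mem h x hx) x hx]

variable [IsIsometricSMul H X]

theorem IsMinimalSubspace.dist_map_eq (hC : IsMinimalSubspace H C) (hX : IsCAT0 X) {f : X → X}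
    (hf : IsEquivIsomOn (id : H → H) C f) {x y : X} (hx : x ∈ C) (hy : y ∈ C) :
    dist x (f x) = dist y (f y) := by
  refine hC.eq_of_convex hX (f := fun z => dist z (f z))
    (continuous_dist.comp_continuousOn (continuousOn_id.prodMk hf.continuousOn))
    (fun a ha b hb => ?_) (fun h z hz => ?_) hx hy
  · rw [hf.map_mid hC.1.convex hX hX ha hb]
    exact hX.dist_mid_mid_le _ _ _ _
  · rw [hf.map_smul h z hz, id, dist_smul]

theorem IsMinimalSubspace.two_mul_dist_map_le (hC : IsMinimalSubspace H C) (hX : IsCAT0 X)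
    {f : X → X} (hf : IsEquivIsomOn (id : H → H) C f) (hmaps : Set.MapsTo f C C) {x : X}
    (hx : x ∈ C) : 2 * dist x (f x) ≤ dist x (f (f x)) := by
  have hdist := hC.dist_map_eq hX hf hx (hC.1.convex.mid_mem hX hx (hmaps hx))
  rw [hf.map_mid hC.1.convex hX hX hx (hmaps hx), hX.mid_comm x] at hdist
  linarith [hX.dist_mid_mid_left_le (f x) x (f (f x))]

theorem IsMinimalSubspace.pow_mul_dist_map_le (hC : IsMinimalSubspace H C) (hX : IsCAT0 X)
    {f : X → X} (hf : IsEquivIsomOn (id : H → H) C f) (hmaps : Set.MapsTo f C C) {x : X}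
    (hx : x ∈ C) (k : ℕ) : 2 ^ k * dist x (f x) ≤ dist x (f^[2 ^ k] x) := by
  induction k with
  | zero => simp
  | succ k ih =>
    have hdouble := hC.two_mul_dist_map_le hX (hf.iterate hmaps (2 ^ k)) (hmaps.iterate _) hx
    rw [← Function.iterate_add_apply, ← mul_two, ← pow_succ] at hdouble
    rw [pow_succ]
    linarith

theorem IsTame.eq_self_of_isEquivIsomOn (hT : IsTame H X) (hX : IsCAT0 X)
    (hC : IsMinimalSubspace H C) {f : X → X} (hf : IsEquivIsomOn (id : H → H) C f)
    (hmaps : Set.MapsTo f C C) {x : X} (hx : x ∈ C) : f x = x := by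
  obtain ⟨R, hR⟩ := (hT x).subset_closedBall x
  by_contra hne
  have hpos : 0 < dist x (f x) := dist_pos.2 (Ne.symm hne)
  obtain ⟨k, hk⟩ := pow_unbounded_of_one_lt (R / dist x (f x)) (one_lt_two (α := ℝ))
  have hmem : f^[2 ^ k] x ∈ Metric.closedBall x R :=
    hR ⟨(hf.iterate hmaps _).mem_subDisplacement hC.1 hx,
      (hC.orbitHull_eq hx).symm ▸ hmaps.iterate _ hx⟩
  rw [Metric.mem_closedBall, dist_comm] at hmem
  rw [div_lt_iff₀ hpos] at hk
  linarith [hC.pow_mul_dist_map_le hX hf hmaps hx k]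

variable [CompleteSpace X]

theorem IsTame.eq_proj_of_isEquivIsomOn (hT : IsTame H X) (hX : IsCAT0 X)
    (hC : IsMinimalSubspace H C) (hC' : IsMinimalSubspace H C') {f : X → X}
    (hf : IsEquivIsomOn (id : H → H) C f) (hmaps : Set.MapsTo f C C') {x : X} (hx : x ∈ C) :
    f x = proj C' x := by
  have hself : proj C (f x) = x := hT.eq_self_of_isEquivIsomOn hX hC
    ((hC'.isEquivIsomOn_proj hC hX).comp hf hmaps)
    (fun _ _ => hC.isConvexSubspace.proj_mem hX _) hx
  rw [← hC'.proj_proj hC hX (hmaps hx), hself]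

theorem IsTame.proj_proj (hT : IsTame H X) (hX : IsCAT0 X) (hC₀ : IsMinimalSubspace H C₀)
    (hC : IsMinimalSubspace H C) (hC' : IsMinimalSubspace H C') {x : X} (hx : x ∈ C₀) :
    proj C' (proj C x) = proj C' x :=
  hT.eq_proj_of_isEquivIsomOn hX hC₀ hC'
    ((hC.isEquivIsomOn_proj hC' hX).comp (hC₀.isEquivIsomOn_proj hC hX)
      fun _ _ => hC.isConvexSubspace.proj_mem hX _)
    (fun _ _ => hC'.isConvexSubspace.proj_mem hX _) hx

theorem IsTame.dist_proj_proj_eq_infDist (hT : IsTame H X) (hX : IsCAT0 X)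
    (hC₀ : IsMinimalSubspace H C₀) (hC : IsMinimalSubspace H C) (hC' : IsMinimalSubspace H C')
    {x y : X} (hx : x ∈ C₀) (hy : y ∈ C) :
    dist (proj C x) (proj C' x) = Metric.infDist y C' := by
  rw [← hT.proj_proj hX hC₀ hC hC' hx, hC'.isConvexSubspace.dist_proj hX]
  exact hC.infDist_eq hC'.1 hX (hC.isConvexSubspace.proj_mem hX x) hy

variable (H X) in
/-- The union of the minimal subspaces. -/
def minimalUnion : Set X := {x | ∃ C, IsMinimalSubspace H C ∧ x ∈ C}

theorem IsTame.isClosed_minimalUnion (hT : IsTame H X) (hX : IsCAT0 X) :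
    IsClosed (minimalUnion H X) := by
  refine isSeqClosed_iff_isClosed.1 fun x a hx ha => ?_
  choose D hD hxD using hx
  have hlim (z : X) (hz : z ∈ D 0) :
      ∃ w, Filter.Tendsto (fun k => proj (D k) z) Filter.atTop (nhds w) := by
    refine cauchySeq_tendsto_of_complete (Metric.cauchySeq_iff.2 fun ε hε => ?_)
    obtain ⟨N, hN⟩ := Metric.cauchySeq_iff.1 ha.cauchySeq ε hε
    refine ⟨N, fun k hk l hl => lt_of_le_of_lt ?_ (hN k hk l hl)⟩
    rw [hT.dist_proj_proj_eq_infDist hX (hD 0) (hD k) (hD l) hz (hxD k)]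
    exact Metric.infDist_le_dist_of_mem (hxD l)
  choose! f hf using hlim
  have hequiv : IsEquivIsomOn (id : H → H) (D 0) f :=
    .of_tendsto (hD 0).1 (fun k => (hD 0).isEquivIsomOn_proj (hD k) hX) hf
  have hp : proj (D 0) a ∈ D 0 := (hD 0).isConvexSubspace.proj_mem hX a
  refine ⟨_, (hD 0).image hX hX Function.surjective_id hequiv, _, hp,
    tendsto_nhds_unique (hf _ hp) (ha.congr_dist ?_)⟩
  refine squeeze_zero (fun _ => dist_nonneg) (fun k => ?_) (tendsto_iff_dist_tendsto_zero.1 ha)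
  rw [← (hD k).proj_proj (hD 0) hX (hxD k)]
  calc dist (proj (D k) (proj (D 0) (x k))) (proj (D k) (proj (D 0) a))
      ≤ dist (proj (D 0) (x k)) (proj (D 0) a) :=
        (hD k).isConvexSubspace.dist_proj_proj_le hX _ _
    _ ≤ dist (x k) a := (hD 0).isConvexSubspace.dist_proj_proj_le hX _ _
    _ = dist (proj (D k) (proj (D 0) (x k))) a := by rw [(hD k).proj_proj (hD 0) hX (hxD k)]

theorem mid_mem_minimalUnion (hX : IsCAT0 X) {x y : X} (hx : x ∈ minimalUnion H X)
    (hy : y ∈ minimalUnion H X) : hX.mid x y ∈ minimalUnion H X := by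
  obtain ⟨C, hC, hxC⟩ := hx
  obtain ⟨C', hC', hyC'⟩ := hy
  exact hC.exists_mid_mem hC' hX hxC hyC'

end Rigidity

section Components

variable {H X : Type*} [Group H] [MetricSpace X] [MulAction H X] [IsIsometricSMul H X]
  [CompleteSpace X] {C C₀ C' : Set X} {z₀ : X}

variable (H) in
/-- The projections of `z₀` to the minimal subspaces. For `z₀` in a minimal subspace and a tame
action, this is a model, inside `X`, of the space of components. -/
def transversal (z₀ : X) : Set X := {x | ∃ C, IsMinimalSubspace H C ∧ proj C z₀ = x}

theorem isBounded_transversal (hX : IsCAT0 X) (hb : Bornology.IsBounded (subDisplacement H z₀)) :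
    Bornology.IsBounded (transversal H z₀) := by
  refine hb.subset ?_
  rintro _ ⟨C, hC, rfl⟩
  exact hC.1.proj_mem_subDisplacement hX z₀

theorem IsMinimalSubspace.transversal_eq (hC₀ : IsMinimalSubspace H C₀) (hX : IsCAT0 X)
    (hz₀ : z₀ ∈ C₀) : transversal H z₀ = minimalUnion H X ∩ proj C₀ ⁻¹' {z₀} := by
  ext x
  constructor
  · rintro ⟨C, hC, rfl⟩
    exact ⟨⟨C, hC, hC.isConvexSubspace.proj_mem hX z₀⟩, hC₀.proj_proj hC hX hz₀⟩
  · rintro ⟨⟨C, hC, hx⟩, hxz : proj C₀ x = z₀⟩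
    exact ⟨C, hC, by rw [← hxz, hC.proj_proj hC₀ hX hx]⟩

theorem IsTame.mid_mem_transversal (hT : IsTame H X) (hX : IsCAT0 X)
    (hC₀ : IsMinimalSubspace H C₀) (hz₀ : z₀ ∈ C₀) {x y : X} (hx : x ∈ transversal H z₀)
    (hy : y ∈ transversal H z₀) : hX.mid x y ∈ transversal H z₀ := by
  obtain ⟨C, hC, rfl⟩ := hx
  obtain ⟨C', hC', rfl⟩ := hy
  have hmaps : Set.MapsTo (proj C) C₀ C := fun _ _ => hC.isConvexSubspace.proj_mem hX _
  refine ⟨_, hC.image_mid_proj hC' hX, ?_⟩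
  rw [← hT.proj_proj hX hC₀ hC hC' hz₀]
  exact (hT.eq_proj_of_isEquivIsomOn hX hC₀ (hC.image_mid_proj hC' hX)
    ((hC.isEquivIsomOn_mid_proj hC' hX).comp (hC₀.isEquivIsomOn_proj hC hX) hmaps)
    ((Set.mapsTo_image _ C).comp hmaps) hz₀).symm

theorem IsTame.isConvexSubspace_transversal (hT : IsTame H X) (hX : IsCAT0 X)
    (hC₀ : IsMinimalSubspace H C₀) (hz₀ : z₀ ∈ C₀) : IsConvexSubspace (transversal H z₀) := by
  have hclosed : IsClosed (transversal H z₀) := by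
    rw [hC₀.transversal_eq hX hz₀]
    exact (hT.isClosed_minimalUnion hX).inter
      (isClosed_singleton.preimage (hC₀.isConvexSubspace.continuous_proj hX))
  exact ⟨⟨_, C₀, hC₀, rfl⟩, hclosed, hX.isGeodConvex_of_mid_mem hclosed
    fun x hx y hy => hT.mid_mem_transversal hX hC₀ hz₀ hx hy⟩

theorem IsTame.setDist_eq_dist_proj (hT : IsTame H X) (hX : IsCAT0 X)
    (hC₀ : IsMinimalSubspace H C₀) (hz₀ : z₀ ∈ C₀) (hC : IsMinimalSubspace H C)
    (hC' : IsMinimalSubspace H C') : setDist C C' = dist (proj C z₀) (proj C' z₀) := by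
  have hp := hC.isConvexSubspace.proj_mem hX z₀
  rw [hC.setDist_eq_infDist hC'.1 hX hp, hT.dist_proj_proj_eq_infDist hX hC₀ hC hC' hz₀ hp]

theorem IsTame.radiusAt_transversal_le_iff (hT : IsTame H X) (hX : IsCAT0 X)
    (hC₀ : IsMinimalSubspace H C₀) (hz₀ : z₀ ∈ C₀)
    (hb : Bornology.IsBounded (transversal H z₀)) (hC : IsMinimalSubspace H C) {r : ℝ} :
    radiusAt (transversal H z₀) (proj C z₀) ≤ r ↔
      ∀ C', IsMinimalSubspace H C' → setDist C C' ≤ r := by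
  constructor
  · intro hr C' hC'
    rw [hT.setDist_eq_dist_proj hX hC₀ hz₀ hC hC']
    exact (dist_le_radiusAt hb _ ⟨C', hC', rfl⟩).trans hr
  · intro hr
    have hle (y : X) (hy : y ∈ transversal H z₀) : dist (proj C z₀) y ≤ r := by
      obtain ⟨C', hC', rfl⟩ := hy
      exact (hT.setDist_eq_dist_proj hX hC₀ hz₀ hC hC').symm.trans_le (hr C' hC')
    exact radiusAt_le (dist_nonneg.trans (hle _ ⟨C, hC, rfl⟩)) hle

theorem IsTame.isCentralComponent_iff (hT : IsTame H X) (hX : IsCAT0 X)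
    (hC₀ : IsMinimalSubspace H C₀) (hz₀ : z₀ ∈ C₀)
    (hb : Bornology.IsBounded (transversal H z₀)) :
    IsCentralComponent H C ↔ IsMinimalSubspace H C ∧
      IsMinOn (radiusAt (transversal H z₀)) (transversal H z₀) (proj C z₀) := by
  refine and_congr_right fun hC => ⟨?_, fun hmin => ?_⟩
  · rintro ⟨ρ, hρ, hleast⟩ _ ⟨C', hC', rfl⟩
    exact ((hT.radiusAt_transversal_le_iff hX hC₀ hz₀ hb hC).2 hρ).trans <| hleast C' _ hC' <|
      (hT.radiusAt_transversal_le_iff hX hC₀ hz₀ hb hC').1 le_rfl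
  · refine ⟨_, (hT.radiusAt_transversal_le_iff hX hC₀ hz₀ hb hC).1 le_rfl, fun C' r hC' hr => ?_⟩
    exact (hmin ⟨C', hC', rfl⟩).trans
      ((hT.radiusAt_transversal_le_iff hX hC₀ hz₀ hb hC').2 hr)

theorem existsUnique_isCentralComponent [Nonempty X] (hX : IsCAT0 X)
    (hb : ∀ x : X, Bornology.IsBounded (subDisplacement H x)) :
    ∃! Z : Set X, IsCentralComponent H Z := by
  have hT : IsTame H X := fun x => (hb x).subset Set.inter_subset_left
  obtain ⟨C₀, hC₀⟩ := hT.exists_isMinimalSubspace hX (Classical.arbitrary X)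
  obtain ⟨z₀, hz₀⟩ := hC₀.1.nonempty
  have hconv := hT.isConvexSubspace_transversal hX hC₀ hz₀
  have hbT := isBounded_transversal hX (hb z₀)
  obtain ⟨_, ⟨Z, hZ, rfl⟩, hmin⟩ :=
    hconv.exists_radiusAt_sq_add_dist_sq_le hX hbT hconv.nonempty
  refine ⟨Z, (hT.isCentralComponent_iff hX hC₀ hz₀ hbT).2 ⟨hZ, fun x hx => ?_⟩, fun Z' hZ' => ?_⟩
  · exact le_of_sq_le_sq (by linarith [hmin x hx, sq_nonneg (dist (proj Z z₀) x)])
      (radiusAt_nonneg _ _)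
  · obtain ⟨hZ'min, hZ'le⟩ := (hT.isCentralComponent_iff hX hC₀ hz₀ hbT).1 hZ'
    have hsq := pow_le_pow_left₀ (radiusAt_nonneg _ _)
      (isMinOn_iff.1 hZ'le (proj Z z₀) ⟨Z, hZ, rfl⟩) 2
    have hdist : dist (proj Z z₀) (proj Z' z₀) ^ 2 ≤ 0 := by
      linarith [hmin (proj Z' z₀) ⟨Z', hZ'min, rfl⟩]
    have heq : proj Z z₀ = proj Z' z₀ := dist_eq_zero.1 (sq_nonpos_iff _ |>.1 hdist)
    exact hZ'min.eq_of_mem hZ (heq ▸ hZ'min.isConvexSubspace.proj_mem hX z₀)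
      (hZ.isConvexSubspace.proj_mem hX z₀)

end Components

section Canonicity

variable {H K X Y : Type*} [Group H] [Group K] [MetricSpace X] [MetricSpace Y] [MulAction H X]
  [MulAction K Y]

theorem setDist_image {f : X → Y} (hf : Isometry f) (A B : Set X) :
    setDist (f '' A) (f '' B) = setDist A B := by
  simp only [setDist, Set.exists_mem_image, hf.dist_eq]

variable [CompleteSpace X]

theorem IsMinimalSubspace.image_isometryEquiv {C : Set X} (hC : IsMinimalSubspace H C)
    (hX : IsCAT0 X) (hY : IsCAT0 Y) (φ : X ≃ᵢ Y) (ψ : H ≃* K)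
    (hφ : ∀ (h : H) (x : X), φ (h • x) = ψ h • φ x) : IsMinimalSubspace K (φ '' C) :=
  hC.image hX hY ψ.surjective ⟨fun x _ y _ => φ.dist_eq x y, fun h x _ => hφ h x⟩

theorem IsCentralComponent.image_isometryEquiv {Z : Set X} (hZ : IsCentralComponent H Z)
    (hX : IsCAT0 X) (hY : IsCAT0 Y) (φ : X ≃ᵢ Y) (ψ : H ≃* K)
    (hφ : ∀ (h : H) (x : X), φ (h • x) = ψ h • φ x) : IsCentralComponent K (φ '' Z) := by
  have : CompleteSpace Y := φ.symm.completeSpace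
  have hφ' (k : K) (y : Y) : φ.symm (k • y) = ψ.symm k • φ.symm y := by
    rw [φ.symm_apply_eq, hφ, ψ.apply_symm_apply, φ.apply_symm_apply]
  have himage (C : Set Y) : φ '' (φ.symm '' C) = C := by
    rw [φ.image_symm, Set.image_preimage_eq _ φ.surjective]
  obtain ⟨hmin, ρ, hρ, hleast⟩ := hZ
  refine ⟨hmin.image_isometryEquiv hX hY φ ψ hφ, ρ, fun C hC => ?_, fun C r hC hr => ?_⟩
  · rw [← himage C, setDist_image φ.isometry]
    exact hρ _ (hC.image_isometryEquiv hY hX φ.symm ψ.symm hφ')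
  · refine hleast _ r (hC.image_isometryEquiv hY hX φ.symm ψ.symm hφ') fun C' hC' => ?_
    rw [← setDist_image φ.isometry, himage]
    exact hr _ (hC'.image_isometryEquiv hX hY φ ψ hφ)

end Canonicity

section Evanescence

variable {G X : Type*} [Group G] [TopologicalSpace G] [MetricSpace X] [MulAction G X]

theorem isBounded_of_not_isEvanescent (hG : ¬ IsEvanescent G X) {T : Set X} {b : G → ℝ}
    (hb : Continuous b) (h : ∀ g, ∀ t ∈ T, dist (g • t) t ≤ b g) : Bornology.IsBounded T := by
  by_contra hT
  refine hG ⟨T, hT, fun Q hQ => ?_⟩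
  obtain ⟨M, hM⟩ := hQ.bddAbove_image hb.continuousOn
  refine (Metric.isBounded_Icc 0 M).subset ?_
  rintro _ ⟨g, hg, x, hx, rfl⟩
  exact ⟨dist_nonneg, (h g x hx).trans (hM ⟨g, hg, rfl⟩)⟩

theorem isBounded_subDisplacement [ContinuousSMul G X] (hG : ¬ IsEvanescent G X) (x : X) :
    Bornology.IsBounded (subDisplacement G x) :=
  isBounded_of_not_isEvanescent hG (b := fun g => dist (g • x) x) (by fun_prop)
    fun g _ ht => ht g

theorem IsEvanescent.of_isometry {Y : Type*} [MetricSpace Y] [MulAction G Y] {f : X → Y}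
    (hX : IsEvanescent G X) (hf : Isometry f) (hmap : ∀ (g : G) (x : X), f (g • x) = g • f x) :
    IsEvanescent G Y := by
  obtain ⟨T, hT, hbounded⟩ := hX
  refine ⟨f '' T, fun hfT => hT ?_, fun Q hQ => (hbounded Q hQ).subset ?_⟩
  · exact (hf.antilipschitz.isBounded_preimage hfT).subset (Set.subset_preimage_image f T)
  · rintro _ ⟨g, hg, _, ⟨x, hx, rfl⟩, rfl⟩
    exact ⟨g, hg, x, hx, by rw [← hmap, hf.dist_eq]⟩

end Evanescence

section Subspace

variable {H X : Type*} [Group H] [MetricSpace X] [MulAction H X] {C : Set X}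

theorem IsGeodesic.comp_isometry {Y : Type*} [MetricSpace Y] {x y : X} {γ : ℝ → X}
    (hγ : IsGeodesic x y γ) {f : X → Y} (hf : Isometry f) : IsGeodesic (f x) (f y) (f ∘ γ) where
  source := congrArg f hγ.source
  target := by rw [hf.dist_eq, Function.comp_apply, hγ.target]
  isometry s hs t ht := by
    rw [hf.dist_eq] at hs ht
    exact (hf.dist_eq _ _).trans (hγ.isometry s hs t ht)

theorem IsGeodConvex.isCAT0 (hC : IsGeodConvex C) (hX : IsCAT0 X) : IsCAT0 C where
  exists_geodesic x y := by
    obtain ⟨γ, hγ⟩ := hX.exists_geodesic (x : X) y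
    have h0 : 0 ≤ dist x y := dist_nonneg
    have hproj {t : ℝ} (ht : t ∈ Set.Icc 0 (dist x y)) : (Set.projIcc 0 _ h0 t : ℝ) = t := by
      rw [Set.projIcc_of_mem h0 ht]
    refine ⟨fun t => ⟨γ (Set.projIcc 0 _ h0 t), hC x x.2 y y.2 γ hγ _ (Subtype.coe_prop _)⟩,
      Subtype.ext ?_, Subtype.ext ?_, fun s hs t ht => ?_⟩
    · exact (congrArg γ (hproj (Set.left_mem_Icc.2 h0))).trans hγ.source
    · exact (congrArg γ (hproj (Set.right_mem_Icc.2 h0))).trans hγ.target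
    · change dist (γ (Set.projIcc 0 _ h0 s)) (γ (Set.projIcc 0 _ h0 t)) = |s - t|
      rw [hproj hs, hproj ht]
      exact hγ.isometry s hs t ht
  bruhat_tits x c c' γ hγ :=
    hX.bruhat_tits x c c' (fun t => γ t) (hγ.comp_isometry isometry_subtype_coe)

/-- The action on an invariant subspace. -/
abbrev IsInvariantSubspace.mulAction (hC : IsInvariantSubspace H C) : MulAction H C where
  smul h x := ⟨h • (x : X), hC.smul_mem h x x.2⟩
  one_smul x := Subtype.ext (one_smul H (x : X))
  mul_smul g h x := Subtype.ext (mul_smul g h (x : X))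

theorem IsInvariantSubspace.isIsometricSMul [IsIsometricSMul H X] (hC : IsInvariantSubspace H C) :
    letI := hC.mulAction
    IsIsometricSMul H C :=
  letI := hC.mulAction
  ⟨fun h => Isometry.of_dist_eq fun x y => dist_smul h (x : X) y⟩

theorem IsInvariantSubspace.continuousSMul [TopologicalSpace H] [ContinuousSMul H X]
    (hC : IsInvariantSubspace H C) :
    letI := hC.mulAction
    ContinuousSMul H C :=
  letI := hC.mulAction
  ⟨Continuous.subtype_mk (continuous_fst.smul (continuous_subtype_val.comp continuous_snd)) _⟩

theorem IsMinimalSubspace.isMinimalSubspace_univ [CompleteSpace X] (hC : IsMinimalSubspace H C)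
    (hX : IsCAT0 X) :
    letI := hC.1.mulAction
    IsMinimalSubspace H (Set.univ : Set C) := by
  let := hC.1.mulAction
  have hCX : IsCAT0 C := hC.1.convex.isCAT0 hX
  have : CompleteSpace C := hC.1.isClosed.completeSpace_coe
  have : Nonempty C := hC.1.nonempty.to_subtype
  refine ⟨hCX.isInvariantSubspace Set.univ_nonempty isClosed_univ (by simp) (by simp),
    fun D hD _ x _ => ?_⟩
  have himage : IsInvariantSubspace H ((↑) '' D : Set X) := hD.image hCX hX
    Function.surjective_id ⟨fun _ _ _ _ => rfl, fun _ _ _ => rfl⟩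
  exact Subtype.val_injective.mem_set_image.1 (hC.2 himage (Subtype.coe_image_subset C D) x.2)

end Subspace

section Foliation

variable {H K X : Type*} [Group H] [MetricSpace X] [MulAction H X]

theorem orbitHull_smul (h : H) (x : X) : orbitHull H (h • x) = orbitHull H x := by
  have hx := (isInvariantSubspace_orbitHull (H := H) x).smul_mem h x (mem_orbitHull x)
  have hy := (isInvariantSubspace_orbitHull (H := H) (h • x)).smul_mem h⁻¹ _ (mem_orbitHull _)
  rw [inv_smul_smul] at hy
  exact ((isInvariantSubspace_orbitHull x).orbitHull_subset hx).antisymm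
    ((isInvariantSubspace_orbitHull _).orbitHull_subset hy)

theorem IsEquivIsomOn.dist_map_le {f : X → X} (hf : IsEquivIsomOn (id : H → H) Set.univ f)
    [IsIsometricSMul H X] (hX : IsCAT0 X) {x t : X} (ht : t ∈ orbitHull H x) :
    dist (f t) t ≤ dist (f x) x := by
  have hinv : IsInvariantSubspace H {t | dist (f t) t ≤ dist (f x) x} := by
    have hcont : Continuous f := continuousOn_univ.1 hf.continuousOn
    refine hX.isInvariantSubspace ⟨x, le_refl (dist (f x) x)⟩
      (isClosed_le (hcont.dist continuous_id) continuous_const) ?_ ?_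
    · intro y (hy : dist (f y) y ≤ _) z (hz : dist (f z) z ≤ _)
      change dist (f (hX.mid y z)) (hX.mid y z) ≤ _
      rw [hX.map_mid hX (f := f) (hf.dist_eq _ trivial _ trivial)
        (hf.dist_eq _ trivial _ trivial).le (hf.dist_eq _ trivial _ trivial).le]
      linarith [hX.dist_mid_mid_le (f y) (f z) y z]
    · intro h t ht
      change dist (f (h • t)) (h • t) ≤ _
      rwa [hf.map_smul h t trivial, id, dist_smul]
  exact hinv.orbitHull_subset (le_refl (dist (f x) x)) ht

variable (H) in
/-- The coordinate of `z` along the leaf of `z₀`, when the sets `orbitHull H x` are the leaves of a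
foliation of `X`. -/
noncomputable def leafCoord (z₀ z : X) : X := proj (orbitHull H z₀) z

variable (H) in
/-- The coordinate of `z` transverse to the leaves `orbitHull H x`, as a point of the transversal
through `z₀`: the point of the leaf of `z` that has the same leaf coordinate as `z₀`. -/
noncomputable def transverseCoord (z₀ z : X) : X := proj (orbitHull H z) z₀

theorem transverseCoord_smul (z₀ : X) (h : H) (z : X) :
    transverseCoord H z₀ (h • z) = transverseCoord H z₀ z := by
  rw [transverseCoord, orbitHull_smul, transverseCoord]

variable [CompleteSpace X]

theorem leafCoord_mem (hX : IsCAT0 X) (z₀ z : X) : leafCoord H z₀ z ∈ orbitHull H z₀ :=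
  (isInvariantSubspace_orbitHull z₀).isConvexSubspace.proj_mem hX z

theorem continuous_leafCoord (hX : IsCAT0 X) (z₀ : X) : Continuous (leafCoord H z₀) :=
  (isInvariantSubspace_orbitHull z₀).isConvexSubspace.continuous_proj hX

theorem transverseCoord_mem (hX : IsCAT0 X) (z₀ z : X) :
    transverseCoord H z₀ z ∈ orbitHull H z :=
  (isInvariantSubspace_orbitHull z).isConvexSubspace.proj_mem hX z₀

variable [IsIsometricSMul H X]

theorem leafCoord_smul (hX : IsCAT0 X) (z₀ : X) (h : H) (z : X) :
    leafCoord H z₀ (h • z) = h • leafCoord H z₀ z :=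
  (isInvariantSubspace_orbitHull z₀).proj_smul hX h z

theorem IsTame.isMinimalSubspace_orbitHull [Group K] [MulAction K X] (hT : IsTame H X)
    (hX : IsCAT0 X) (hmin : IsMinimalSubspace K (Set.univ : Set X))
    (hsmul : ∀ k : K, ∀ x ∈ minimalUnion H X, k • x ∈ minimalUnion H X) (z : X) :
    IsMinimalSubspace H (orbitHull H z) := by
  obtain ⟨C, hC⟩ := hT.exists_isMinimalSubspace hX z
  have hinv : IsInvariantSubspace K (minimalUnion H X) := hX.isInvariantSubspace
    (hC.1.nonempty.mono fun x hx => ⟨C, hC, hx⟩) (hT.isClosed_minimalUnion hX)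
    (fun x hx y hy => mid_mem_minimalUnion hX hx hy) hsmul
  obtain ⟨D, hD, hz⟩ := hmin.2 hinv (Set.subset_univ _) (Set.mem_univ z)
  rwa [hD.orbitHull_eq hz]

variable (hK : ∀ z : X, IsMinimalSubspace H (orbitHull H z)) (hX : IsCAT0 X)
include hK hX

theorem leafCoord_transverseCoord {z₀ y : X} (hy : y ∈ orbitHull H z₀) (z : X) :
    leafCoord H z₀ (transverseCoord H y z) = y :=
  (hK z₀).proj_proj (hK z) hX hy

variable (hT : IsTame H X)
include hT

theorem dist_sq_eq_leafCoord_add (z₀ z w : X) :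
    dist z w ^ 2 = dist (leafCoord H z₀ z) (leafCoord H z₀ w) ^ 2 +
      dist (transverseCoord H z₀ z) (transverseCoord H z₀ w) ^ 2 := by
  have hz := mem_orbitHull (H := H) z
  have hw := mem_orbitHull (H := H) w
  have hp : proj (orbitHull H w) z ∈ orbitHull H w := transverseCoord_mem hX z w
  have hleaf : dist (proj (orbitHull H w) z) w = dist (leafCoord H z₀ z) (leafCoord H z₀ w) := by
    rw [← ((hK w).isEquivIsomOn_proj (hK z₀) hX).dist_eq _ hp w hw,
      hT.proj_proj hX (hK z) (hK w) (hK z₀) hz]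
    rfl
  rw [(hK z).dist_sq_eq (hK w) hX hz hw, hleaf,
    ← hT.dist_proj_proj_eq_infDist hX (hK z₀) (hK z) (hK w) (mem_orbitHull z₀) hz]
  rfl

theorem leafCoord_mid (z₀ x y : X) :
    leafCoord H z₀ (hX.mid x y) = hX.mid (leafCoord H z₀ x) (leafCoord H z₀ y) :=
  (hX.map_mid_of_dist_sq_eq_add hX hX (dist_sq_eq_leafCoord_add hK hX hT z₀) x y).1

theorem transverseCoord_mid (z₀ x y : X) :
    transverseCoord H z₀ (hX.mid x y) =
      hX.mid (transverseCoord H z₀ x) (transverseCoord H z₀ y) :=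
  (hX.map_mid_of_dist_sq_eq_add hX hX (dist_sq_eq_leafCoord_add hK hX hT z₀) x y).2

theorem leafCoord_map {f : X → X} (hf : IsEquivIsomOn (id : H → H) Set.univ f) (z₀ z : X) :
    leafCoord H z₀ (f z) = leafCoord H z₀ z := by
  have hfC := hf.mono (Set.subset_univ (orbitHull H z))
  have himage := (hK z).image hX hX Function.surjective_id hfC
  exact hT.eq_proj_of_isEquivIsomOn hX (hK z) (hK z₀)
    ((himage.isEquivIsomOn_proj (hK z₀) hX).comp hfC (Set.mapsTo_image _ _))
    (fun _ _ => leafCoord_mem hX z₀ _) (mem_orbitHull z)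

theorem transverseCoord_map {f : X → X} (hf : IsEquivIsomOn (id : H → H) Set.univ f)
    (z₀ z : X) : transverseCoord H z₀ (f z) = f (transverseCoord H z₀ z) := by
  have hfC := hf.mono (Set.subset_univ (orbitHull H z))
  have hmem : f (transverseCoord H z₀ z) ∈ orbitHull H (f z) := by
    rw [((hK z).image hX hX Function.surjective_id hfC).orbitHull_eq
      (Set.mem_image_of_mem f (mem_orbitHull z))]
    exact Set.mem_image_of_mem f (transverseCoord_mem hX z₀ z)
  have hcoord : leafCoord H z₀ (f (transverseCoord H z₀ z)) = z₀ := by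
    rw [leafCoord_map hK hX hT hf, leafCoord_transverseCoord hK hX (mem_orbitHull z₀)]
  rw [← (hK (f z)).proj_proj (hK z₀) hX hmem]
  exact congrArg _ hcoord.symm

theorem leafCoord_eq_of_mem_orbitHull [Group K] [MulAction K X] [IsIsometricSMul K X]
    [SMulCommClass K H X] (z₀ : X) {z w : X} (hw : w ∈ orbitHull K z) :
    leafCoord H z₀ w = leafCoord H z₀ z := by
  have hinv : IsInvariantSubspace K {w | leafCoord H z₀ w = leafCoord H z₀ z} := by
    refine hX.isInvariantSubspace ⟨z, rfl⟩
      (isClosed_eq (continuous_leafCoord hX z₀) continuous_const) ?_ ?_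
    · intro x (hx : leafCoord H z₀ x = _) y (hy : leafCoord H z₀ y = _)
      change leafCoord H z₀ (hX.mid x y) = _
      rw [leafCoord_mid hK hX hT, hx, hy, hX.mid_self]
    · intro k x hx
      exact (leafCoord_map hK hX hT (f := (k • ·))
        ⟨fun _ _ _ _ => dist_smul _ _ _, fun h x _ => smul_comm k h x⟩ z₀ x).trans hx
  exact hinv.orbitHull_subset rfl hw

end Foliation

section Product

variable {ι : Type*} [DecidableEq ι] {G : ι → Type*} [∀ i, Group (G i)] {X : Type*}
  [MetricSpace X] [MulAction (∀ i, G i) X] [∀ i, MulAction (G i) X]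
  (hs : ∀ (i : ι) (a : G i) (x : X), a • x = (Pi.mulSingle i a : ∀ j, G j) • x)
include hs

omit [MetricSpace X] in
theorem smulCommClass_of_ne {i j : ι} (hij : i ≠ j) : SMulCommClass (G i) (G j) X where
  smul_comm a b x := by
    simp only [hs, smul_smul, (Pi.mulSingle_commute hij a b).eq]

omit [MetricSpace X] in
theorem smul_eq_smul_update_smul (i : ι) (g : ∀ j, G j) (x : X) :
    g • x = g i • (Function.update g i 1 • x) := by
  rw [hs, smul_smul]
  congr 1
  ext j
  obtain rfl | hj := eq_or_ne j i
  · simp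
  · simp [hj]

variable [IsIsometricSMul (∀ i, G i) X]

theorem isEquivIsomOn_smul_of_apply_eq_one {i : ι} {g : ∀ j, G j} (hg : g i = 1) :
    IsEquivIsomOn (id : G i → G i) Set.univ fun x : X => g • x where
  dist_eq x _ y _ := dist_smul g x y
  map_smul a x _ := by
    rw [id, hs, hs, smul_smul, smul_smul]
    congr 1
    ext j
    obtain rfl | hj := eq_or_ne j i
    · simp [hg]
    · simp [hj]

variable [∀ i, IsIsometricSMul (G i) X] (hX : IsCAT0 X)
include hX

theorem isTame_of_not_isEvanescent [∀ i, TopologicalSpace (G i)] [ContinuousSMul (∀ i, G i) X]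
    (hG : ¬ IsEvanescent (∀ i, G i) X) (i : ι) : IsTame (G i) X := by
  intro x
  refine isBounded_of_not_isEvanescent hG
    (b := fun g => dist (g i • x) x + dist (Function.update g i 1 • x) x) ?_ ?_
  · simp only [hs]
    fun_prop
  · rintro g t ⟨htx, ht⟩
    calc dist (g • t) t
        ≤ dist (g i • (Function.update g i 1 • t)) (g i • t) + dist (g i • t) t := by
          rw [smul_eq_smul_update_smul hs i g t]
          exact dist_triangle _ _ _
      _ = dist (g i • t) t + dist (Function.update g i 1 • t) t := by rw [dist_smul, add_comm]
      _ ≤ dist (g i • x) x + dist (Function.update g i 1 • x) x :=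
          add_le_add (htx (g i)) ((isEquivIsomOn_smul_of_apply_eq_one hs
            (Function.update_self i 1 g)).dist_map_le hX ht)

variable [CompleteSpace X]

omit [∀ i, IsIsometricSMul (G i) X] in
theorem smul_mem_minimalUnion (i : ι) (g : ∀ j, G j) {x : X} (hx : x ∈ minimalUnion (G i) X) :
    g • x ∈ minimalUnion (G i) X := by
  obtain ⟨C, hC, hxC⟩ := hx
  have himage := hC.image hX hX Function.surjective_id
    ((isEquivIsomOn_smul_of_apply_eq_one hs (Function.update_self i 1 g)).mono
      (Set.subset_univ C))
  refine ⟨_, himage, ?_⟩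
  rw [smul_eq_smul_update_smul hs i g x]
  exact himage.1.smul_mem (g i) _ (Set.mem_image_of_mem _ hxC)

variable (hT : ∀ i, IsTame (G i) X)
  (hK : ∀ i (z : X), IsMinimalSubspace (G i) (orbitHull (G i) z))
include hT hK

theorem leafCoord_smul_of_product (i : ι) (z₀ : X) (g : ∀ j, G j) (z : X) :
    leafCoord (G i) z₀ (g • z) = g i • leafCoord (G i) z₀ z := by
  rw [smul_eq_smul_update_smul hs i g z, leafCoord_smul hX, leafCoord_map (hK i) hX (hT i)
    (isEquivIsomOn_smul_of_apply_eq_one hs (Function.update_self i 1 g))]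

theorem transverseCoord_smul_of_product (i : ι) (z₀ : X) (g : ∀ j, G j) (z : X) :
    transverseCoord (G i) z₀ (g • z) = Function.update g i 1 • transverseCoord (G i) z₀ z := by
  rw [smul_eq_smul_update_smul hs i g z, transverseCoord_smul, transverseCoord_map (hK i) hX (hT i)
    (isEquivIsomOn_smul_of_apply_eq_one hs (Function.update_self i 1 g))]

omit [IsIsometricSMul (∀ i, G i) X] in
theorem leafCoord_transverseCoord_of_ne {i j : ι} (hij : i ≠ j) (z₀ y z : X) :
    leafCoord (G j) z₀ (transverseCoord (G i) y z) = leafCoord (G j) z₀ z :=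
  have := smulCommClass_of_ne hs hij
  leafCoord_eq_of_mem_orbitHull (hK j) hX (hT j) z₀ (transverseCoord_mem hX y z)

omit hs hT hK in
variable (G) in
/-- The map `r` is what remains of the identity of `X` after splitting off the leaf coordinates of
the factors `G i` with `i ∈ S`. -/
structure IsRemainder (z₀ : X) (S : Finset ι) (r : X → X) : Prop where
  dist_sq_eq : ∀ z w, dist z w ^ 2 =
    ∑ i ∈ S, dist (leafCoord (G i) z₀ z) (leafCoord (G i) z₀ w) ^ 2 + dist (r z) (r w) ^ 2
  leafCoord_eq : ∀ i ∉ S, ∀ z, leafCoord (G i) z₀ (r z) = leafCoord (G i) z₀ z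
  map_mid : ∀ x y, r (hX.mid x y) = hX.mid (r x) (r y)
  map_smul : ∀ (g : ∀ i, G i) z, r (g • z) = (S.piecewise 1 g : ∀ i, G i) • r z

theorem IsRemainder.insert {z₀ : X} {S : Finset ι} {r : X → X} (hr : IsRemainder G hX z₀ S r)
    {a : ι} (ha : a ∉ S) :
    IsRemainder G hX z₀ (insert a S) (transverseCoord (G a) z₀ ∘ r) where
  dist_sq_eq z w := by
    rw [hr.dist_sq_eq, dist_sq_eq_leafCoord_add (hK a) hX (hT a) z₀ (r z), Finset.sum_insert ha,
      hr.leafCoord_eq a ha, hr.leafCoord_eq a ha, add_left_comm, add_assoc]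
    rfl
  leafCoord_eq i hi z := by
    rw [Finset.mem_insert, not_or] at hi
    rw [Function.comp_apply, leafCoord_transverseCoord_of_ne hs hX hT hK (Ne.symm hi.1),
      hr.leafCoord_eq i hi.2]
  map_mid x y := by
    simp only [Function.comp_apply, hr.map_mid, transverseCoord_mid (hK a) hX (hT a)]
  map_smul g z := by
    rw [Function.comp_apply, hr.map_smul, transverseCoord_smul_of_product hs hX hT hK,
      Finset.piecewise_insert]
    rfl

theorem exists_isRemainder (z₀ : X) (S : Finset ι) : ∃ r, IsRemainder G hX z₀ S r := by
  induction S using Finset.induction_on with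
  | empty => exact ⟨id, by simp, by simp, by simp, by simp⟩
  | insert a S ha ih =>
    obtain ⟨r, hr⟩ := ih
    exact ⟨_, hr.insert hs hX hT hK ha⟩

omit [IsIsometricSMul (∀ i, G i) X] in
theorem exists_leafCoord_eq (z₀ : X) {y : ι → X} (hy : ∀ i, y i ∈ orbitHull (G i) z₀)
    (S : Finset ι) : ∃ z, ∀ i ∈ S, leafCoord (G i) z₀ z = y i := by
  induction S using Finset.induction_on with
  | empty => exact ⟨z₀, by simp⟩
  | insert a S ha ih =>
    obtain ⟨z, hz⟩ := ih
    refine ⟨transverseCoord (G a) (y a) z, fun i hi => ?_⟩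
    obtain rfl | hia := eq_or_ne i a
    · exact leafCoord_transverseCoord (hK i) hX (hy i) z
    · rw [leafCoord_transverseCoord_of_ne hs hX hT hK hia.symm,
        hz i (Finset.mem_of_mem_insert_of_ne hi hia)]

variable [Fintype ι]

omit hs hT hK [∀ i, IsIsometricSMul (G i) X] [IsIsometricSMul (∀ i, G i) X] [CompleteSpace X] in
theorem IsRemainder.eq_of_univ {z₀ : X} {r : X → X}
    (hr : IsRemainder G hX z₀ Finset.univ r)
    (hmin : IsMinimalSubspace (∀ i, G i) (Set.univ : Set X)) (z w : X) : r z = r w := by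
  have hle : ∀ x y, dist (r x) (r y) ≤ dist x y := fun x y => by
    refine le_of_sq_le_sq ?_ dist_nonneg
    rw [hr.dist_sq_eq x y]
    exact le_add_of_nonneg_left (Finset.sum_nonneg fun _ _ => sq_nonneg _)
  have hcont : Continuous r :=
    (LipschitzWith.of_dist_le_mul (K := 1) fun x y => by simpa using hle x y).continuous
  have hinv : IsInvariantSubspace (∀ i, G i) {z | r z = r w} := by
    refine hX.isInvariantSubspace ⟨w, rfl⟩ (isClosed_eq hcont continuous_const) ?_ ?_
    · intro x (hx : r x = r w) y (hy : r y = r w)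
      change r (hX.mid x y) = r w
      rw [hr.map_mid, hx, hy, hX.mid_self]
    · intro g x (hx : r x = r w)
      change r (g • x) = r w
      rw [hr.map_smul, Finset.piecewise_univ, one_smul, hx]
  exact hmin.2 hinv (Set.subset_univ _) (Set.mem_univ z)

variable (hmin : IsMinimalSubspace (∀ i, G i) (Set.univ : Set X))
include hmin

theorem dist_sq_eq_sum_leafCoord (z₀ z w : X) :
    dist z w ^ 2 = ∑ i, dist (leafCoord (G i) z₀ z) (leafCoord (G i) z₀ w) ^ 2 := by
  obtain ⟨r, hr⟩ := exists_isRemainder hs hX hT hK z₀ Finset.univ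
  rw [hr.dist_sq_eq z w, hr.eq_of_univ hX hmin z w, dist_self]
  simp

theorem exists_isometryEquiv_leaves (z₀ : X) :
    ∃ α : X ≃ᵢ PiLp 2 fun i => orbitHull (G i) z₀,
      ∀ z i, (α z i : X) = leafCoord (G i) z₀ z := by
  let f : X → PiLp 2 fun i => orbitHull (G i) z₀ := fun z =>
    WithLp.toLp 2 fun i => ⟨leafCoord (G i) z₀ z, leafCoord_mem hX z₀ z⟩
  have hf : Isometry f := Isometry.of_dist_eq fun z w => by
    rw [PiLp.dist_eq_sum (by simp), ← Real.sqrt_sq (dist_nonneg (x := z) (y := w)),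
      dist_sq_eq_sum_leafCoord hs hX hT hK hmin z₀ z w, Real.sqrt_eq_rpow]
    simp only [ENNReal.toReal_ofNat, Real.rpow_ofNat]
    rfl
  have hsurj : Function.Surjective f := fun y => by
    obtain ⟨z, hz⟩ := exists_leafCoord_eq hs hX hT hK z₀ (fun i => (y i).2) Finset.univ
    exact ⟨z, PiLp.ext fun i => Subtype.ext (hz i (Finset.mem_univ i))⟩
  exact ⟨IsometryEquiv.mk' f (Function.surjInv hsurj) (Function.surjInv_eq hsurj) hf,
    fun _ _ => rfl⟩

end Product

theorem exists_splitting {ι : Type*} [Fintype ι] {G : ι → Type v} {X : Type u}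
    [∀ i, Group (G i)] [∀ i, TopologicalSpace (G i)] [MetricSpace X] [CompleteSpace X]
    [MulAction (∀ i, G i) X] [IsIsometricSMul (∀ i, G i) X] [ContinuousSMul (∀ i, G i) X]
    (hX : IsCAT0 X) (hG : ¬ IsEvanescent (∀ i, G i) X)
    (hmin : IsMinimalSubspace (∀ i, G i) (Set.univ : Set X)) :
    ∃ (Y : ι → Type u) (_ : ∀ i, MetricSpace (Y i)) (_ : ∀ i, MulAction (G i) (Y i))
      (α : X ≃ᵢ PiLp 2 Y),
      (∀ i, CompleteSpace (Y i)) ∧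
      (∀ i, IsCAT0 (Y i)) ∧
      (∀ i, IsIsometricSMul (G i) (Y i)) ∧
      (∀ i, ContinuousSMul (G i) (Y i)) ∧
      (∀ i, IsMinimalSubspace (G i) (Set.univ : Set (Y i))) ∧
      ∀ (g : ∀ i, G i) (z : X) (i : ι), α (g • z) i = g i • α z i := by
  classical
  let action (i : ι) : MulAction (G i) X := MulAction.compHom X (MonoidHom.mulSingle G i)
  have hs (i : ι) (a : G i) (x : X) : a • x = (Pi.mulSingle i a : ∀ j, G j) • x := rfl
  have isometric (i : ι) : IsIsometricSMul (G i) X :=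
    ⟨fun a => isometry_smul X (Pi.mulSingle i a : ∀ j, G j)⟩
  have continuous (i : ι) : ContinuousSMul (G i) X :=
    ⟨((continuous_mulSingle i).comp continuous_fst).smul continuous_snd⟩
  have hT := isTame_of_not_isEvanescent hs hX hG
  have hK (i : ι) : ∀ z : X, IsMinimalSubspace (G i) (orbitHull (G i) z) :=
    (hT i).isMinimalSubspace_orbitHull hX hmin fun g _ => smul_mem_minimalUnion hs hX i g
  obtain ⟨z₀, -⟩ := hmin.1.nonempty
  obtain ⟨α, hα⟩ := exists_isometryEquiv_leaves hs hX hT hK hmin z₀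
  have hleaf (i : ι) : IsInvariantSubspace (G i) (orbitHull (G i) z₀) := (hK i z₀).1
  refine ⟨fun i => orbitHull (G i) z₀, fun i => inferInstance, fun i => (hleaf i).mulAction, α,
    fun i => (hleaf i).isClosed.completeSpace_coe, fun i => (hleaf i).convex.isCAT0 hX,
    fun i => (hleaf i).isIsometricSMul, fun i => (hleaf i).continuousSMul,
    fun i => (hK i z₀).isMinimalSubspace_univ hX, fun g z i => Subtype.ext ?_⟩
  rw [hα, leafCoord_smul_of_product hs hX hT hK]
  exact congrArg (g i • ·) (hα z i).symm

end CatZero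

theorem theorem9_general {ι : Type*} [Fintype ι] {G : ι → Type v} {X : Type u}
    [∀ i, Group (G i)] [∀ i, TopologicalSpace (G i)]
    [MetricSpace X] [CompleteSpace X] [Nonempty X] (hX : CatZero.IsCAT0 X)
    [MulAction (∀ i, G i) X] [IsIsometricSMul (∀ i, G i) X] [ContinuousSMul (∀ i, G i) X] :
    CatZero.IsEvanescent (∀ i, G i) X ∨
    ∃ Z : Set X,
      CatZero.IsInvariantSubspace (∀ i, G i) Z ∧
      CatZero.IsCentralComponent (∀ i, G i) Z ∧
      (∀ Z' : Set X, CatZero.IsCentralComponent (∀ i, G i) Z' → Z' = Z) ∧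
      (∀ (φ : X ≃ᵢ X) (ψ : (∀ i, G i) ≃* (∀ i, G i)),
        (∀ (g : ∀ i, G i) (x : X), φ (g • x) = ψ g • φ x) → φ '' Z = Z) ∧
      ∃ (Y : ι → Type u) (_ : ∀ i, MetricSpace (Y i)) (_ : ∀ i, MulAction (G i) (Y i))
        (α : Z ≃ᵢ PiLp 2 Y),
        (∀ i, CompleteSpace (Y i)) ∧
        (∀ i, CatZero.IsCAT0 (Y i)) ∧
        (∀ i, IsIsometricSMul (G i) (Y i)) ∧
        (∀ i, ContinuousSMul (G i) (Y i)) ∧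
        (∀ i, CatZero.IsMinimalSubspace (G i) (Set.univ : Set (Y i))) ∧
        (∀ (g : ∀ i, G i) (z w : Z), (w : X) = g • (z : X) →
          ∀ i, α w i = g i • α z i) := by
  by_cases hG : CatZero.IsEvanescent (∀ i, G i) X
  · exact Or.inl hG
  obtain ⟨Z, hZ, huniq⟩ := CatZero.existsUnique_isCentralComponent (H := ∀ i, G i) hX
    (CatZero.isBounded_subDisplacement hG)
  have hinv := hZ.1.1
  let := hinv.mulAction
  have := hinv.isIsometricSMul
  have := hinv.continuousSMul
  have : CompleteSpace Z := hinv.isClosed.completeSpace_coe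
  have hGZ : ¬ CatZero.IsEvanescent (∀ i, G i) Z := fun h =>
    hG (h.of_isometry isometry_subtype_coe fun _ _ => rfl)
  obtain ⟨Y, metric, action, α, hcomplete, hcat, hiso, hcont, hmin, hα⟩ :=
    CatZero.exists_splitting (hinv.convex.isCAT0 hX) hGZ (hZ.1.isMinimalSubspace_univ hX)
  refine Or.inr ⟨Z, hinv, hZ, huniq,
    fun φ ψ hφ => huniq _ (hZ.image_isometryEquiv hX hX φ ψ hφ),
    Y, metric, action, α, hcomplete, hcat, hiso, hcont, hmin, fun g z w hw i => ?_⟩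
  rw [show w = g • z from Subtype.ext hw, hα]

theorem theorem9 {n : ℕ} {G : Fin n → Type v} {X : Type u}
    [∀ i, Group (G i)] [∀ i, TopologicalSpace (G i)] [∀ i, IsTopologicalGroup (G i)]
    [MetricSpace X] [CompleteSpace X] [Nonempty X] (hX : CatZero.IsCAT0 X)
    [MulAction (∀ i, G i) X] [IsIsometricSMul (∀ i, G i) X] [ContinuousSMul (∀ i, G i) X] :
    CatZero.IsEvanescent (∀ i, G i) X ∨
    ∃ Z : Set X,
      -- `Z` is a non-empty closed convex invariant subspace
      CatZero.IsInvariantSubspace (∀ i, G i) Z ∧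
      -- `Z` is canonical: it is the unique circumcentre of the space of components,
      -- and it is preserved by all isometries of `X` that normalise the action
      CatZero.IsCentralComponent (∀ i, G i) Z ∧
      (∀ Z' : Set X, CatZero.IsCentralComponent (∀ i, G i) Z' → Z' = Z) ∧
      (∀ (φ : X ≃ᵢ X) (ψ : (∀ i, G i) ≃* (∀ i, G i)),
        (∀ (g : ∀ i, G i) (x : X), φ (g • x) = ψ g • φ x) → φ '' Z = Z) ∧
      -- `Z` splits equivariantly and isometrically as the `ℓ²`-product of minimal `G i`-spaces
      ∃ (Y : Fin n → Type u) (_ : ∀ i, MetricSpace (Y i)) (_ : ∀ i, MulAction (G i) (Y i))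
        (α : Z ≃ᵢ PiLp 2 Y),
        (∀ i, CompleteSpace (Y i)) ∧
        (∀ i, CatZero.IsCAT0 (Y i)) ∧
        (∀ i, IsIsometricSMul (G i) (Y i)) ∧
        (∀ i, ContinuousSMul (G i) (Y i)) ∧
        (∀ i, CatZero.IsMinimalSubspace (G i) (Set.univ : Set (Y i))) ∧
        (∀ (g : ∀ i, G i) (z w : Z), (w : X) = g • (z : X) →
          ∀ i, α w i = g i • α z i) :=
  theorem9_general hX
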